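/- **Setting.** Inner products are antilinear in the first argument. Let $\mathcal H=L^2(\mathbb R^3,\mathbb C^4)$, let $\alpha^1,\alpha^2,\alpha^3,\beta$ be self-adjoint $4\times4$ matrices with $\{\alpha^i,\alpha^j\}=2\delta^{ij}$, $\{\alpha^k,\beta\}=0$, $\beta^2=I$, let $m\in\mathbb R$, and let $H=-i\nabla\cdot\alpha+\beta m$ be the Dirac Hamiltonian, $\omega=\sqrt{-\Delta+m^2}$, $P^\pm=(\omega\pm H)/(2\omega)$ and $\mathcal H^\pm=P^\pm\mathcal H$, so $\mathcal H=\mathcal H^+\oplus\mathcal H^-$. A charge conjugation is an antilinear map $\mathcal C$ on $\mathcal H$ with $\mathcal C^2=I$, $(\mathcal C\psi,\mathcal C\chi)=(\chi,\psi)$ and $\mathcal CP^\pm=P^\mp\mathcal C$. A compatible basis is an orthonormal basis $\{e_i\}_{i\in\mathbb Z\setminus\{0\}}$ of $\mathcal H$ with $e_i\in\mathcal H^+$ for $i>0$ and $e_i\in\mathcal H^-$ for $i<0$. *Dirac sea.* $\mathcal H(\Lambda_\infty)$ is the Hilbert space with orthonormal basis $e_I=e_{i_1}\wedge e_{i_2}\wedge\cdots$,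 where $I=(i_1>i_2>\cdots)$ runs over the strictly decreasing sequences of nonzero integers with $i_{k+1}=i_k-1$ for all large $k$. The bounded operators $\psi(e_j),\psi^*(e_j)$ are given by $\psi(e_j)e_I=(-1)^{s+1}e_{i_1}\wedge\cdots\wedge e_{i_{s-1}}\wedge e_{i_{s+1}}\wedge\cdots$ if $j=i_s$, and $\psi(e_j)e_I=0$ if $j$ does not occur in $I$; $\psi^*(e_j)e_I=0$ if $j$ occurs in $I$, and otherwise $\psi^*(e_j)e_I=(-1)^se_{i_1}\wedge\cdots\wedge e_{i_s}\wedge e_j\wedge e_{i_{s+1}}\wedge\cdots$, where $s$ is the number of entries of $I$ greater than $j$. Put $\Omega_{\mathcal D}=e_{-1}\wedge e_{-2}\wedge e_{-3}\wedge\cdots$ and, for $f\in\mathcal H$, $\psi(f)=\sum_i(f,e_i)\psi(e_i)$, $\psi^*(f)=\sum_i(e_i,f)\psi^*(e_i)$. For $h\in\mathcal H^+$ let $a(h)=\psi(h)$ and $b(h)=\psi^*(\mathcal Ch)$, and let $\psi(t,f)=\psi(e^{iHt}f)$. *Fock space.* $\mathcal F(\mathcal H^+)=\bigoplus_{n\ge0}\bigwedge^n\mathcal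 H^+$ is the fermion Fock space over $\mathcal H^+$, with no-particle state $\Omega_0$, annihilation operators $\alpha(h)$ and number operator $N$. On the Hilbert space tensor product $\mathcal F=\mathcal F(\mathcal H^+)\otimes\mathcal F(\mathcal H^+)$ let $\Omega_0=\Omega_0\otimes\Omega_0$, $a(h)=\alpha(h)\otimes I$, $b(h)=(-1)^N\otimes\alpha(h)$ for $h\in\mathcal H^+$, $\psi(f)=a(P^+f)+b(\mathcal CP^-f)^*$ and $\psi(t,f)=\psi(e^{iHt}f)$ for $f\in\mathcal H$. **Theorem.** Compatible bases and charge conjugations exist. For every compatible basis the series defining $\psi(f)$ and $\psi^*(f)$ converge unconditionally in operator norm for all $f\in\mathcal H$; and for every compatible basis and every charge conjugation $\mathcal C$ there is a unitary operator $U:\mathcal H(\Lambda_\infty)\to\mathcal F$ such that $U\Omega_{\mathcal D}=\Omega_0$ and, for all $h\in\mathcal H^+$, $t\in\mathbb R$, $f\in\mathcal H$, $$U\,a(h)\,U^{-1}=a(h),\qquad U\,b(h)\,U^{-1}=b(h),\qquad U\,\psi(t,f)\,U^{-1}=\psi(t,f),$$ with the Dirac sea operators on the left and the Fock space operators on the right.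 -/

import Mathlib

open MeasureTheory
open scoped FourierTransform ENNReal

noncomputable section

namespace DiracSea

/-- Nonzero integers. -/
abbrev NZ : Type := {i : ℤ // i ≠ 0}

/-- A strictly decreasing sequence `i₁ > i₂ > i₃ > …` of nonzero integers with `iₖ₊₁ = iₖ - 1` for
all large `k`. -/
@[ext]
structure SeaSeq where
  seq : ℕ → ℤ
  ne_zero : ∀ k, seq k ≠ 0
  anti : ∀ k, seq (k + 1) < seq k
  filled : ∃ K, ∀ k, K ≤ k → seq (k + 1) = seq k - 1

namespace SeaSeq

theorem seq_strictAnti (I : SeaSeq) : StrictAnti I.seq := strictAnti_nat_of_succ_lt I.anti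

theorem exists_le (I : SeaSeq) (j : ℤ) : ∃ k, I.seq k ≤ j := by
  have h : ∀ k : ℕ, I.seq k ≤ I.seq 0 - k := by
    intro k
    induction k with
    | zero => simp
    | succ k ih => have := I.anti k; push_cast; omega
  refine ⟨(I.seq 0 - j).toNat, (h _).trans ?_⟩
  have := Int.self_le_toNat (I.seq 0 - j)
  omega

/-- The number of entries of `I` that are greater than `j`; the entries at the (zero-based) places
`0, …, pos I j - 1` are `> j`, all later entries are `≤ j`. -/
def pos (I : SeaSeq) (j : ℤ) : ℕ := Nat.find (I.exists_le j)

theorem seq_pos_le (I : SeaSeq) (j : ℤ) : I.seq (I.pos j) ≤ j := Nat.find_spec (I.exists_le j)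

theorem lt_seq (I : SeaSeq) (j : ℤ) {k : ℕ} (h : k < I.pos j) : j < I.seq k :=
  not_le.1 (Nat.find_min (I.exists_le j) h)

theorem pos_eq (I : SeaSeq) (j : ℤ) (s : ℕ) (h1 : I.seq s ≤ j) (h2 : ∀ k < s, j < I.seq k) :
    I.pos j = s :=
  (Nat.find_eq_iff _).2 ⟨h1, fun k hk => not_le.2 (h2 k hk)⟩

/-- Membership of `j` in the sequence `I`. -/
def Has (I : SeaSeq) (j : ℤ) : Prop := ∃ s, I.seq s = j

theorem has_iff (I : SeaSeq) (j : ℤ) : I.Has j ↔ I.seq (I.pos j) = j := by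
  refine ⟨?_, fun h => ⟨_, h⟩⟩
  rintro ⟨s, rfl⟩
  congr 1
  exact I.pos_eq _ s le_rfl fun k hk => I.seq_strictAnti hk

/-- Omit the entry at the (zero-based) place `s`. -/
def erase (I : SeaSeq) (s : ℕ) : SeaSeq where
  seq k := if k < s then I.seq k else I.seq (k + 1)
  ne_zero k := by split_ifs <;> exact I.ne_zero _
  anti k := by
    have h1 := I.anti k
    have h2 := I.anti (k + 1)
    split_ifs <;> omega
  filled := by
    obtain ⟨K, hK⟩ := I.filled
    refine ⟨K + s, fun k hk => ?_⟩
    rw [if_neg (by omega), if_neg (by omega)]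
    exact hK _ (by omega)

/-- Insert the nonzero integer `j`, which does not occur in `I`, at its place. -/
def insert (I : SeaSeq) (j : NZ) (hj : ¬ I.Has j) : SeaSeq where
  seq k := if k < I.pos j then I.seq k else if k = I.pos j then j else I.seq (k - 1)
  ne_zero k := by
    split_ifs
    · exact I.ne_zero _
    · exact j.2
    · exact I.ne_zero _
  anti k := by
    have h1 := I.anti k
    have h2 := I.anti (k - 1)
    have h3 := I.seq_pos_le j
    have h4 := fun h : k < I.pos j => I.lt_seq j h
    have h5 : I.seq (I.pos j) ≠ j := fun h => hj ⟨_, h⟩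
    rcases lt_trichotomy k (I.pos j) with h | h | h
    · rw [if_pos h]
      rcases Nat.lt_or_ge (k + 1) (I.pos j) with h' | h'
      · rw [if_pos h']; exact h1
      · rw [if_neg (by omega), if_pos (by omega)]; exact h4 h
    · rw [if_neg (by omega), if_neg (by omega), if_neg (by omega), if_pos h, h]
      simp only [Nat.add_sub_cancel]
      omega
    · rw [if_neg (by omega), if_neg (by omega), if_neg (by omega), if_neg (by omega)]
      have : k - 1 + 1 = k := by omega
      rw [this] at h2
      simpa using h2
  filled := by
    obtain ⟨K, hK⟩ := I.filled
    refine ⟨K + I.pos j + 1, fun k hk => ?_⟩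
    rw [if_neg (by omega), if_neg (by omega), if_neg (by omega), if_neg (by omega)]
    have := hK (k - 1) (by omega)
    have e : k - 1 + 1 = k := by omega
    rw [e] at this
    simpa using this

theorem insert_pos (I : SeaSeq) (j : NZ) (hj : ¬ I.Has j) : (I.insert j hj).pos j = I.pos j := by
  apply pos_eq
  · simp [insert]
  · intro k hk
    simp only [insert, if_pos hk]
    exact I.lt_seq j hk

theorem insert_has (I : SeaSeq) (j : NZ) (hj : ¬ I.Has j) : (I.insert j hj).Has j :=
  ⟨I.pos j, by simp [insert]⟩

theorem erase_insert (I : SeaSeq) (j : NZ) (hj : ¬ I.Has j) :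
    (I.insert j hj).erase (I.pos j) = I := by
  ext k
  simp only [erase, insert]
  split_ifs <;> first | rfl | omega

theorem erase_pos (I : SeaSeq) (j : ℤ) (hj : I.Has j) : (I.erase (I.pos j)).pos j = I.pos j := by
  rw [has_iff] at hj
  apply pos_eq
  · simp only [erase, lt_irrefl, if_false]
    have := I.anti (I.pos j)
    omega
  · intro k hk
    simp only [erase, if_pos hk]
    exact I.lt_seq j hk

theorem erase_not_has (I : SeaSeq) (j : ℤ) (hj : I.Has j) : ¬ (I.erase (I.pos j)).Has j := by
  rw [has_iff, erase_pos I j hj]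
  rw [has_iff] at hj
  simp only [erase, lt_irrefl, if_false]
  have := I.anti (I.pos j)
  omega

theorem insert_erase (I : SeaSeq) (j : NZ) (hj : I.Has j) :
    (I.erase (I.pos j)).insert j (I.erase_not_has j hj) = I := by
  have h := (I.has_iff j).1 hj
  ext k
  simp only [insert, erase_pos I j hj]
  simp only [erase]
  split_ifs with h1 h2 h3
  · rfl
  · rw [h2, h]
  · omega
  · congr 1; omega

open Classical in
/-- Removing `j` from the sequences that contain it, as a partial bijection of the set of sequences;
its inverse inserts `j` into the sequences that do not contain it. -/
def remove (j : NZ) : SeaSeq ≃. SeaSeq where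
  toFun I := if I.Has j then some (I.erase (I.pos j)) else none
  invFun I := if h : I.Has j then none else some (I.insert j h)
  inv I J := by
    by_cases hI : I.Has j <;> by_cases hJ : J.Has j <;>
      simp only [hI, hJ, if_true, if_false, dite_true, dite_false,
        Option.some.injEq, reduceCtorEq, iff_false, false_iff]
    · rintro rfl
      exact I.erase_not_has j hI hJ
    · constructor
      · rintro rfl
        rw [J.insert_pos j hJ, J.erase_insert j hJ]
      · rintro rfl
        exact I.insert_erase j hI
    · rintro rfl
      exact hI (J.insert_has j hJ)

/-- The filled sea `(-1, -2, -3, …)`. -/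
def sea : SeaSeq where
  seq k := -((k : ℤ) + 1)
  ne_zero k := by omega
  anti k := by push_cast; omega
  filled := ⟨0, fun k _ => by push_cast; omega⟩

end SeaSeq

/-- The semi-infinite wedge product: the Hilbert space in which the vectors
`e_I = e_{i₁} ∧ e_{i₂} ∧ …` form an orthonormal basis. -/
abbrev SeaSpace : Type := lp (fun _ : SeaSeq => ℂ) 2

open Classical in
/-- The basis vector `e_I`. -/
def seaVec (I : SeaSeq) : SeaSpace := lp.single 2 I (1 : ℂ)

theorem sum_elim_le {ι : Type*} (σ : ι ≃. ι) (g : ι → ℝ) (C : ℝ)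
    (hC : ∀ s : Finset ι, ∑ i ∈ s, g i ≤ C) (s : Finset ι) :
    ∑ i ∈ s, (σ.symm i).elim 0 g ≤ C := by
  classical
  have key : ∀ s : Finset ι, ∑ i ∈ s, (σ.symm i).elim 0 g =
      ∑ i ∈ s.biUnion (fun i => (σ.symm i).toFinset), g i := by
    intro s
    rw [Finset.sum_biUnion]
    · refine Finset.sum_congr rfl fun i _ => ?_
      cases σ.symm i <;> simp
    · intro a _ b _ hab
      rw [Function.onFun, Finset.disjoint_left]
      intro x hx hx'
      exact hab (σ.symm.inj (Option.mem_toFinset.1 hx) (Option.mem_toFinset.1 hx'))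
  rw [key]
  exact hC _

/-- The bounded operator on `ℓ²(ι)` that sends the basis vector `e_I` to `ε I • e_{σ I}`, or to `0`
where the partial bijection `σ` is undefined. -/
def signedShift {ι : Type*} (σ : ι ≃. ι) (ε : ι → ℤˣ) :
    lp (fun _ : ι => ℂ) 2 →L[ℂ] lp (fun _ : ι => ℂ) 2 :=
  have hle : ∀ (Φ : lp (fun _ : ι => ℂ) 2) (s : Finset ι),
      ∑ J ∈ s, ‖(σ.symm J).elim 0 fun I => ((ε I : ℤ) : ℂ) * Φ I‖ ^ (2 : ENNReal).toReal ≤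
        ‖Φ‖ ^ (2 : ENNReal).toReal := by
    intro Φ s
    refine le_trans (le_of_eq (Finset.sum_congr rfl fun J _ => ?_))
      (sum_elim_le σ (fun I => ‖Φ I‖ ^ (2 : ENNReal).toReal) _
        (fun s => lp.sum_rpow_le_norm_rpow (by norm_num) Φ s) s)
    cases σ.symm J with
    | none => simp
    | some I => rcases Int.units_eq_one_or (ε I) with h | h <;> simp [h]
  LinearMap.mkContinuous
    { toFun := fun Φ => ⟨fun J => (σ.symm J).elim 0 fun I => ((ε I : ℤ) : ℂ) * Φ I,
        memℓp_gen' (hle Φ)⟩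
      map_add' := fun Φ Ψ => by
        ext J
        simp only [lp.coeFn_add, Pi.add_apply]
        cases σ.symm J <;> simp [mul_add]
      map_smul' := fun c Φ => by
        ext J
        simp only [lp.coeFn_smul, Pi.smul_apply, RingHom.id_apply, smul_eq_mul]
        cases σ.symm J <;> simp [mul_left_comm] }
    1 (fun Φ => by
      rw [one_mul]
      exact lp.norm_le_of_forall_sum_le (by norm_num) (norm_nonneg _) (hle Φ))

open Classical in
theorem signedShift_single {ι : Type*} (σ : ι ≃. ι) (ε : ι → ℤˣ) (I : ι) :
    signedShift σ ε (lp.single 2 I 1) =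
      (σ I).elim 0 fun J => ((ε I : ℤ) : ℂ) • lp.single 2 J (1 : ℂ) := by
  ext J
  show (σ.symm J).elim 0 _ = _
  have h : ∀ K, σ.symm J = some K ↔ σ K = some J := fun K => σ.eq_some_iff
  cases hI : σ I with
  | none =>
    cases hJ : σ.symm J with
    | none => simp
    | some K =>
      have : K ≠ I := by
        rintro rfl
        have := (h K).1 hJ
        simp [hI] at this
      simp [this]
  | some L =>
    cases hJ : σ.symm J with
    | none =>
      have : L ≠ J := by
        rintro rfl
        have := (h I).2 hI
        simp [hJ] at this
      simp [this.symm]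
    | some K =>
      have hK := (h K).1 hJ
      by_cases hKI : K = I
      · subst hKI
        have : L = J := by simpa [hI] using hK
        simp [this]
      · have : J ≠ L := by
          rintro rfl
          exact hKI (σ.inj hK hI)
        simp [hKI, this]

/-- Interior multiplication `ψ(e_j)`: if `j` stands at the zero-based place `s` of `I` then `e_I` is
sent to `(-1)^s e_{I - j}`, and `e_I` is sent to `0` if `j` does not occur in `I`. -/
def psiBasis (j : NZ) : SeaSpace →L[ℂ] SeaSpace :=
  signedShift (SeaSeq.remove j) fun I => (-1) ^ I.pos j

/-- Exterior multiplication `ψ*(e_j)`: if `j` does not occur in `I` and `s` entries of `I` are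
greater than `j` then `e_I` is sent to `(-1)^s e_{I + j}`, and `e_I` is sent to `0` if `j` occurs. -/
def psiStarBasis (j : NZ) : SeaSpace →L[ℂ] SeaSpace :=
  signedShift (SeaSeq.remove j).symm fun I => (-1) ^ I.pos j

/-- The Dirac sea vector `Ω_D = e_{-1} ∧ e_{-2} ∧ e_{-3} ∧ …`. -/
def seaVacuum : SeaSpace := seaVec SeaSeq.sea

theorem psiBasis_of_has (j : NZ) (I : SeaSeq) (h : I.Has j) :
    psiBasis j (seaVec I) = (-1 : ℂ) ^ I.pos j • seaVec (I.erase (I.pos j)) := by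
  rw [psiBasis, seaVec, signedShift_single]
  simp [SeaSeq.remove, h, seaVec]

theorem psiBasis_of_not_has (j : NZ) (I : SeaSeq) (h : ¬ I.Has j) : psiBasis j (seaVec I) = 0 := by
  rw [psiBasis, seaVec, signedShift_single]
  simp [SeaSeq.remove, h]

theorem psiStarBasis_of_has (j : NZ) (I : SeaSeq) (h : I.Has j) :
    psiStarBasis j (seaVec I) = 0 := by
  rw [psiStarBasis, seaVec, signedShift_single]
  simp [SeaSeq.remove, PEquiv.symm, h]

theorem psiStarBasis_of_not_has (j : NZ) (I : SeaSeq) (h : ¬ I.Has j) :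
    psiStarBasis j (seaVec I) = (-1 : ℂ) ^ I.pos j • seaVec (I.insert j h) := by
  rw [psiStarBasis, seaVec, signedShift_single]
  simp [SeaSeq.remove, PEquiv.symm, h, seaVec]

section

variable {H : Type*} [NormedAddCommGroup H] [InnerProductSpace ℂ H]

/-- `ψ(f) = ∑ᵢ (f, eᵢ) ψ(eᵢ)`, a sum in operator norm. -/
def psi (e : HilbertBasis NZ ℂ H) (f : H) : SeaSpace →L[ℂ] SeaSpace :=
  ∑' i, inner ℂ f (e i) • psiBasis i

/-- `ψ*(f) = ∑ᵢ (eᵢ, f) ψ*(eᵢ)`, a sum in operator norm. -/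
def psiStar (e : HilbertBasis NZ ℂ H) (f : H) : SeaSpace →L[ℂ] SeaSpace :=
  ∑' i, inner ℂ (e i) f • psiStarBasis i

end

section

variable {K : Type*} [NormedAddCommGroup K] [InnerProductSpace ℂ K]

variable (K) in
/-- The opposite of the algebra of linear endomorphisms of the exterior algebra, with complex scalars
acting through complex conjugation. -/
def ConjEnd : Type _ := (Module.End ℂ (ExteriorAlgebra ℂ K))ᵐᵒᵖ

instance : Ring (ConjEnd K) := inferInstanceAs (Ring (Module.End ℂ (ExteriorAlgebra ℂ K))ᵐᵒᵖ)

instance : Algebra ℂ (ConjEnd K) :=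
  Algebra.compHom (Module.End ℂ (ExteriorAlgebra ℂ K))ᵐᵒᵖ (starRingEnd ℂ)

/-- The endomorphism underlying an element of `ConjEnd K`. -/
def ConjEnd.toEnd (T : ConjEnd K) : Module.End ℂ (ExteriorAlgebra ℂ K) := MulOpposite.unop T

/-- An endomorphism as an element of `ConjEnd K`. -/
def ConjEnd.ofEnd (T : Module.End ℂ (ExteriorAlgebra ℂ K)) : ConjEnd K := MulOpposite.op T

theorem ConjEnd.ext {S T : ConjEnd K} (h : S.toEnd = T.toEnd) : S = T :=
  MulOpposite.unop_injective h

theorem ConjEnd.toEnd_ofEnd (T : Module.End ℂ (ExteriorAlgebra ℂ K)) : (ofEnd T).toEnd = T := rfl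

theorem ConjEnd.toEnd_zero : (0 : ConjEnd K).toEnd = 0 := rfl

theorem ConjEnd.toEnd_one : (1 : ConjEnd K).toEnd = 1 := rfl

theorem ConjEnd.toEnd_add (S T : ConjEnd K) : (S + T).toEnd = S.toEnd + T.toEnd := rfl

theorem ConjEnd.toEnd_mul (S T : ConjEnd K) : (S * T).toEnd = T.toEnd * S.toEnd := rfl

theorem ConjEnd.toEnd_smul (c : ℂ) (T : ConjEnd K) :
    (c • T).toEnd = starRingEnd ℂ c • T.toEnd := rfl

/-- Contraction of the exterior algebra with the functional `(h, ·)`: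
`f₁ ∧ … ∧ fₙ ↦ ∑ⱼ (-1)^(j-1) (h, fⱼ) f₁ ∧ … f̸ⱼ … ∧ fₙ`. -/
def contract (h : K) : ExteriorAlgebra ℂ K →ₗ[ℂ] ExteriorAlgebra ℂ K :=
  CliffordAlgebra.contractLeft (innerₛₗ ℂ h)

theorem contract_ι_mul (h f : K) (x : ExteriorAlgebra ℂ K) :
    contract h (ExteriorAlgebra.ι ℂ f * x) =
      inner ℂ h f • x - ExteriorAlgebra.ι ℂ f * contract h x :=
  CliffordAlgebra.contractLeft_ι_mul _ _ _

theorem contract_algebraMap (h : K) (r : ℂ) : contract h (algebraMap ℂ _ r) = 0 :=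
  CliffordAlgebra.contractLeft_algebraMap _ (innerₛₗ ℂ h) r

theorem contract_one (h : K) : contract h 1 = 0 :=
  CliffordAlgebra.contractLeft_one _ (innerₛₗ ℂ h)

theorem contract_contract (h : K) (x : ExteriorAlgebra ℂ K) : contract h (contract h x) = 0 :=
  CliffordAlgebra.contractLeft_contractLeft _ _

theorem contract_comm (h f : K) (x : ExteriorAlgebra ℂ K) :
    contract h (contract f x) = - contract f (contract h x) :=
  CliffordAlgebra.contractLeft_comm _ _ _

/-- `f₁ ∧ … ∧ fₙ` is sent to the composition `contract fₙ ∘ … ∘ contract f₁`. -/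
def contractHom : ExteriorAlgebra ℂ K →ₐ[ℂ] ConjEnd K :=
  ExteriorAlgebra.lift ℂ
    ⟨{ toFun := fun h => ConjEnd.ofEnd (contract h)
       map_add' := fun h f => ConjEnd.ext <| by
        rw [ConjEnd.toEnd_add]
        simp only [ConjEnd.toEnd_ofEnd, contract, map_add]
       map_smul' := fun c h => ConjEnd.ext <| by
        rw [RingHom.id_apply, ConjEnd.toEnd_smul]
        simp only [ConjEnd.toEnd_ofEnd, contract, map_smulₛₗ, RingHom.id_apply] },
      fun h => ConjEnd.ext <| by
        rw [ConjEnd.toEnd_mul, ConjEnd.toEnd_zero]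
        exact LinearMap.ext fun x => contract_contract h x⟩

theorem contractHom_ι (h : K) : contractHom (ExteriorAlgebra.ι ℂ h) = ConjEnd.ofEnd (contract h) :=
  ExteriorAlgebra.lift_ι_apply ℂ _ _ _

/-- The sesquilinear form on the exterior algebra for which contraction is adjoint to exterior
multiplication and `(1, y)` is the scalar part of `y`. -/
def extForm (x y : ExteriorAlgebra ℂ K) : ℂ :=
  ExteriorAlgebra.algebraMapInv ((contractHom x).toEnd y)

theorem extForm_add_left (x x' y : ExteriorAlgebra ℂ K) :
    extForm (x + x') y = extForm x y + extForm x' y := by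
  simp only [extForm, map_add, ConjEnd.toEnd_add, LinearMap.add_apply]

theorem extForm_smul_left (c : ℂ) (x y : ExteriorAlgebra ℂ K) :
    extForm (c • x) y = starRingEnd ℂ c * extForm x y := by
  simp only [extForm, map_smul, ConjEnd.toEnd_smul, LinearMap.smul_apply, smul_eq_mul]

theorem extForm_add_right (x y y' : ExteriorAlgebra ℂ K) :
    extForm x (y + y') = extForm x y + extForm x y' := by
  simp only [extForm, map_add]

theorem extForm_smul_right (c : ℂ) (x y : ExteriorAlgebra ℂ K) :
    extForm x (c • y) = c * extForm x y := by
  simp only [extForm, map_smul, smul_eq_mul]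

theorem extForm_one (y : ExteriorAlgebra ℂ K) :
    extForm 1 y = ExteriorAlgebra.algebraMapInv y := by
  simp only [extForm, map_one, ConjEnd.toEnd_one, Module.End.one_apply]

theorem extForm_zero_right (x : ExteriorAlgebra ℂ K) : extForm x 0 = 0 := by
  simp only [extForm, map_zero]

theorem extForm_algebraMap (r : ℂ) (y : ExteriorAlgebra ℂ K) :
    extForm (algebraMap ℂ _ r) y = starRingEnd ℂ r * ExteriorAlgebra.algebraMapInv y := by
  rw [Algebra.algebraMap_eq_smul_one, extForm_smul_left, extForm_one]

theorem extForm_ι_mul (h : K) (x y : ExteriorAlgebra ℂ K) :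
    extForm (ExteriorAlgebra.ι ℂ h * x) y = extForm x (contract h y) := by
  simp only [extForm, map_mul, contractHom_ι, ConjEnd.toEnd_mul, ConjEnd.toEnd_ofEnd,
    Module.End.mul_apply]

theorem algebraMapInv_ι_mul (h : K) (x : ExteriorAlgebra ℂ K) :
    ExteriorAlgebra.algebraMapInv (ExteriorAlgebra.ι ℂ h * x) = 0 := by
  simp [ExteriorAlgebra.algebraMapInv]

theorem ext_induction {P : ExteriorAlgebra ℂ K → Prop} (h0 : ∀ r, P (algebraMap ℂ _ r))
    (h1 : ∀ x y, P x → P y → P (x + y)) (h2 : ∀ x f, P x → P (ExteriorAlgebra.ι ℂ f * x))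
    (x : ExteriorAlgebra ℂ K) : P x :=
  CliffordAlgebra.left_induction 0 h0 h1 h2 x

theorem extForm_contract (h : K) (x : ExteriorAlgebra ℂ K) : ∀ y,
    extForm (contract h x) y = extForm x (ExteriorAlgebra.ι ℂ h * y) := by
  induction x using ext_induction with
  | h0 r =>
    intro y
    rw [contract_algebraMap, extForm_algebraMap, algebraMapInv_ι_mul, mul_zero]
    simp only [extForm, map_zero, ConjEnd.toEnd_zero, LinearMap.zero_apply]
  | h1 x x' hx hx' => intro y; rw [map_add, extForm_add_left, extForm_add_left, hx, hx']
  | h2 x f hx =>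
    intro y
    rw [contract_ι_mul, sub_eq_add_neg, extForm_add_left, ← neg_one_smul ℂ (_ * _),
      extForm_smul_left, extForm_smul_left, extForm_ι_mul, extForm_ι_mul, hx, contract_ι_mul,
      sub_eq_add_neg, extForm_add_right, ← neg_one_smul ℂ (_ * _), extForm_smul_right,
      extForm_smul_right, inner_conj_symm]
    simp

theorem extForm_symm (x : ExteriorAlgebra ℂ K) : ∀ y,
    starRingEnd ℂ (extForm y x) = extForm x y := by
  have h1 : ∀ y : ExteriorAlgebra ℂ K,
      starRingEnd ℂ (extForm y 1) = ExteriorAlgebra.algebraMapInv y := by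
    intro y
    induction y using ext_induction with
    | h0 r => simp [extForm_algebraMap, ExteriorAlgebra.algebraMapInv]
    | h1 y y' hy hy' => rw [extForm_add_left, map_add, hy, hy', map_add]
    | h2 y f hy =>
      rw [extForm_ι_mul, contract_one, algebraMapInv_ι_mul]
      rw [extForm_zero_right, map_zero]
  induction x using ext_induction with
  | h0 r =>
    intro y
    rw [Algebra.algebraMap_eq_smul_one, extForm_smul_left, extForm_one, extForm_smul_right,
      map_mul, h1]
  | h1 x x' hx hx' => intro y; rw [extForm_add_left, extForm_add_right, map_add, hx, hx']
  | h2 x f hx => intro y; rw [extForm_ι_mul, ← hx, extForm_contract]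

/-- Contraction of `w₁ ∧ … ∧ wₙ` with a vector orthogonal to all `wⱼ` vanishes. -/
theorem contract_ιMulti_eq_zero (h : K) : ∀ (n : ℕ) (w : Fin n → K), (∀ j, inner ℂ h (w j) = 0) →
    contract h (ExteriorAlgebra.ιMulti ℂ n w) = 0
  | 0, w, _ => by rw [ExteriorAlgebra.ιMulti_zero_apply, contract_one]
  | n + 1, w, hw => by
    rw [ExteriorAlgebra.ιMulti_succ_apply, contract_ι_mul, hw 0,
      contract_ιMulti_eq_zero h n (Matrix.vecTail w) fun j => hw j.succ]
    simp

theorem extForm_ιMulti_eq_zero : ∀ (n : ℕ) (v : Fin n → K) (k : Fin n) (y : ExteriorAlgebra ℂ K),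
    contract (v k) y = 0 → extForm (ExteriorAlgebra.ιMulti ℂ n v) y = 0
  | 0, v, k, y, h => k.elim0
  | n + 1, v, k, y, h => by
    rw [ExteriorAlgebra.ιMulti_succ_apply, extForm_ι_mul]
    induction k using Fin.cases with
    | zero => rw [h, extForm_zero_right]
    | succ k =>
      apply extForm_ιMulti_eq_zero n _ k
      show contract (v k.succ) _ = 0
      rw [contract_comm, h, map_zero, neg_zero]

theorem extForm_ιMulti_self : ∀ (n : ℕ) (v : Fin n → K), Orthonormal ℂ v →
    extForm (ExteriorAlgebra.ιMulti ℂ n v) (ExteriorAlgebra.ιMulti ℂ n v) = 1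
  | 0, v, _ => by rw [ExteriorAlgebra.ιMulti_zero_apply, extForm_one, map_one]
  | n + 1, v, hv => by
    rw [ExteriorAlgebra.ιMulti_succ_apply, extForm_ι_mul, contract_ι_mul,
      contract_ιMulti_eq_zero (v 0) n (Matrix.vecTail v) fun j => hv.inner_eq_zero (Fin.succ_ne_zero j).symm,
      inner_self_eq_norm_sq_to_K, hv.norm_eq_one]
    simpa using extForm_ιMulti_self n (Matrix.vecTail v) (hv.comp Fin.succ (Fin.succ_injective n))

theorem exists_finiteDimensional (x : ExteriorAlgebra ℂ K) :
    ∃ V : Submodule ℂ K, FiniteDimensional ℂ V ∧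
      x ∈ (ExteriorAlgebra.map V.subtype).range := by
  have mono : ∀ V W : Submodule ℂ K, V ≤ W → (ExteriorAlgebra.map V.subtype).range ≤
      (ExteriorAlgebra.map W.subtype).range := by
    rintro V W h _ ⟨y, rfl⟩
    refine ⟨ExteriorAlgebra.map (Submodule.inclusion h) y, ?_⟩
    have := ExteriorAlgebra.map_comp_map (Submodule.inclusion h) W.subtype
    exact congrArg (fun F => F y) this
  induction x using ext_induction with
  | h0 r => exact ⟨⊥, inferInstance, ⟨algebraMap ℂ _ r, by simp⟩⟩
  | h1 x y hx hy =>
    obtain ⟨V, hV, hx⟩ := hx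
    obtain ⟨W, hW, hy⟩ := hy
    exact ⟨V ⊔ W, inferInstance,
      add_mem (mono V _ le_sup_left hx) (mono W _ le_sup_right hy)⟩
  | h2 x f hx =>
    obtain ⟨V, hV, hx⟩ := hx
    refine ⟨V ⊔ Submodule.span ℂ {f}, inferInstance, mul_mem ?_ (mono V _ le_sup_left hx)⟩
    refine mono (Submodule.span ℂ {f}) _ le_sup_right
      ⟨ExteriorAlgebra.ι ℂ ⟨f, Submodule.mem_span_singleton_self f⟩, ?_⟩
    simp

theorem exists_expansion (x : ExteriorAlgebra ℂ K) :
    ∃ (n : ℕ) (E : Finset (Fin n) → ExteriorAlgebra ℂ K) (c : Finset (Fin n) → ℂ),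
      (∀ s t, extForm (E s) (E t) = if s = t then 1 else 0) ∧ x = ∑ s, c s • E s := by
  obtain ⟨V, hV, y, rfl⟩ := exists_finiteDimensional x
  let b := stdOrthonormalBasis ℂ V
  let u : Fin (Module.finrank ℂ V) → K := fun i => (b i : K)
  have hu : Orthonormal ℂ u := b.orthonormal.comp_linearIsometry V.subtypeₗᵢ
  let B := b.toBasis.ExteriorAlgebra
  have hB : ∀ s, ∃ (n : ℕ) (a : Fin n → Fin (Module.finrank ℂ V)), Function.Injective a ∧
      (∀ i, i ∈ s ↔ i ∈ Set.range a) ∧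
      ExteriorAlgebra.map V.subtype (B s) = ExteriorAlgebra.ιMulti ℂ n (u ∘ a) := by
    intro s
    refine ⟨s.card, Set.powersetCard.ofFinEmbEquiv.symm (Set.powersetCard.prodEquiv.symm s).2,
      ?_, ?_, ?_⟩
    · exact (Set.powersetCard.ofFinEmbEquiv.symm
        (Set.powersetCard.prodEquiv.symm s).2).injective
    · intro i
      exact (Set.powersetCard.mem_range_ofFinEmbEquiv_symm_iff_mem
        (Set.powersetCard.prodEquiv.symm s).2 i).symm
    · rw [ExteriorAlgebra.basis_apply]
      exact ExteriorAlgebra.map_apply_ιMulti V.subtype _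
  refine ⟨_, fun s => ExteriorAlgebra.map V.subtype (B s), B.repr y, ?_, ?_⟩
  · intro s t
    obtain ⟨n, a, ha, has, hs⟩ := hB s
    obtain ⟨m, a', ha', hat, ht⟩ := hB t
    split_ifs with hst
    · subst hst
      simp only [hs]
      exact extForm_ιMulti_self n _ (hu.comp a ha)
    · have zero : ∀ (n m : ℕ) (a : Fin n → Fin (Module.finrank ℂ V))
          (a' : Fin m → Fin (Module.finrank ℂ V)) (k : Fin n), a k ∉ Set.range a' →
          extForm (ExteriorAlgebra.ιMulti ℂ n (u ∘ a)) (ExteriorAlgebra.ιMulti ℂ m (u ∘ a')) = 0 := by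
        intro n m a a' k hk
        refine extForm_ιMulti_eq_zero n _ k _ (contract_ιMulti_eq_zero _ m _ fun j => ?_)
        exact hu.inner_eq_zero fun h => hk ⟨j, h.symm⟩
      simp only [hs, ht]
      by_cases hsub : s ⊆ t
      · have : ¬ t ⊆ s := fun h => hst (Finset.Subset.antisymm hsub h)
        obtain ⟨i, hi, hi'⟩ := Finset.not_subset.1 this
        obtain ⟨k, rfl⟩ := (hat i).1 hi
        rw [← extForm_symm, zero m n a' a k fun h => hi' ((has _).2 h), map_zero]
      · obtain ⟨i, hi, hi'⟩ := Finset.not_subset.1 hsub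
        obtain ⟨k, rfl⟩ := (has i).1 hi
        exact zero n m a a' k fun h => hi' ((hat _).2 h)
  · show ExteriorAlgebra.map V.subtype y = _
    conv_lhs => rw [← B.sum_repr y, map_sum]
    simp

theorem extForm_self (x : ExteriorAlgebra ℂ K) :
    ∃ (n : ℕ) (E : Finset (Fin n) → ExteriorAlgebra ℂ K) (c : Finset (Fin n) → ℂ),
      x = ∑ s, c s • E s ∧ extForm x x = ((∑ s, ‖c s‖ ^ 2 : ℝ) : ℂ) := by
  obtain ⟨n, E, c, hE, hx⟩ := exists_expansion x
  refine ⟨n, E, c, hx, ?_⟩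
  have hl : ∀ (y : ExteriorAlgebra ℂ K), extForm x y = ∑ s, starRingEnd ℂ (c s) * extForm (E s) y := by
    intro y
    let F : ExteriorAlgebra ℂ K →+ ℂ := AddMonoidHom.mk' (fun x => extForm x y)
      fun a b => extForm_add_left a b y
    show F x = _
    rw [hx, map_sum]
    exact Finset.sum_congr rfl fun s _ => extForm_smul_left _ _ _
  have hr : ∀ s, extForm (E s) x = c s := by
    intro s
    let F : ExteriorAlgebra ℂ K →+ ℂ := AddMonoidHom.mk' (fun x => extForm (E s) x)
      fun a b => extForm_add_right _ a b
    show F x = _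
    rw [hx, map_sum]
    have : ∀ t, F (c t • E t) = c t * if s = t then 1 else 0 := fun t => by
      show extForm _ _ = _
      rw [extForm_smul_right, hE]
    simp [this]
  rw [hl]
  push_cast
  refine Finset.sum_congr rfl fun s _ => ?_
  rw [hr, mul_comm, Complex.mul_conj, Complex.normSq_eq_norm_sq]
  push_cast
  rfl

/-- The inner product of the exterior algebra; see `inner_ιMulti` and `inner_ιMulti_of_ne`. -/
instance extCore : InnerProductSpace.Core ℂ (ExteriorAlgebra ℂ K) where
  inner := extForm
  conj_inner_symm x y := extForm_symm x y
  re_inner_nonneg x := by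
    obtain ⟨n, E, c, -, h⟩ := extForm_self x
    show 0 ≤ Complex.re (extForm x x)
    rw [h, Complex.ofReal_re]
    positivity
  add_left := extForm_add_left
  smul_left x y r := extForm_smul_left r x y
  definite x hx := by
    obtain ⟨n, E, c, h1, h⟩ := extForm_self x
    change extForm x x = 0 at hx
    rw [h, Complex.ofReal_eq_zero, Finset.sum_eq_zero_iff_of_nonneg fun _ _ => by positivity] at hx
    rw [h1]
    refine Finset.sum_eq_zero fun s hs => ?_
    have := hx s hs
    rw [norm_eq_zero.1 (pow_eq_zero_iff (two_ne_zero) |>.1 this), zero_smul]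

instance : NormedAddCommGroup (ExteriorAlgebra ℂ K) :=
  InnerProductSpace.Core.toNormedAddCommGroup (𝕜 := ℂ)

instance : InnerProductSpace ℂ (ExteriorAlgebra ℂ K) := InnerProductSpace.ofCore _

theorem inner_ext (x y : ExteriorAlgebra ℂ K) : inner ℂ x y = extForm x y := rfl

theorem norm_contract_le (h : K) (x : ExteriorAlgebra ℂ K) : ‖contract h x‖ ≤ ‖h‖ * ‖x‖ := by
  have h1 : (inner ℂ (contract h x) (contract h x) : ℂ) +
      inner ℂ (ExteriorAlgebra.ι ℂ h * x) (ExteriorAlgebra.ι ℂ h * x) =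
        inner ℂ h h * inner ℂ x x := by
    simp only [inner_ext]
    rw [extForm_contract, extForm_ι_mul, contract_ι_mul, ← extForm_add_right, add_sub_cancel,
      extForm_smul_right]
  simp only [inner_self_eq_norm_sq_to_K] at h1
  have h2 : ‖contract h x‖ ^ 2 + ‖ExteriorAlgebra.ι ℂ h * x‖ ^ 2 = ‖h‖ ^ 2 * ‖x‖ ^ 2 := by
    exact_mod_cast h1
  refine le_of_sq_le_sq ?_ (by positivity)
  nlinarith [sq_nonneg ‖ExteriorAlgebra.ι ℂ h * x‖]


theorem contract_ιMulti (h : K) : ∀ (n : ℕ) (w : Fin (n + 1) → K),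
    contract h (ExteriorAlgebra.ιMulti ℂ (n + 1) w) =
      ∑ j : Fin (n + 1), ((-1) ^ (j : ℕ) * inner ℂ h (w j)) •
        ExteriorAlgebra.ιMulti ℂ n fun i => w (j.succAbove i)
  | 0, w => by
    rw [ExteriorAlgebra.ιMulti_succ_apply, contract_ι_mul, ExteriorAlgebra.ιMulti_zero_apply,
      contract_one]
    simp
  | n + 1, w => by
    rw [ExteriorAlgebra.ιMulti_succ_apply, contract_ι_mul, contract_ιMulti h n, Finset.mul_sum,
      sub_eq_add_neg, ← Finset.sum_neg_distrib]
    conv_rhs => rw [Fin.sum_univ_succ]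
    congr 1
    · simp only [Fin.val_zero, pow_zero, one_mul, Fin.zero_succAbove]
      rfl
    · refine Finset.sum_congr rfl fun j _ => ?_
      rw [ExteriorAlgebra.ιMulti_succ_apply, Fin.val_succ, pow_succ, mul_neg_one, neg_mul,
        neg_smul, mul_smul_comm, Fin.succ_succAbove_zero]
      congr 4
      funext i
      simp [Matrix.vecTail]

/-- The Gram determinant formula. -/
theorem inner_ιMulti : ∀ (n : ℕ) (v w : Fin n → K),
    inner ℂ (ExteriorAlgebra.ιMulti ℂ n v) (ExteriorAlgebra.ιMulti ℂ n w) =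
      Matrix.det (Matrix.of fun i j => inner ℂ (v i) (w j))
  | 0, v, w => by
    rw [inner_ext, ExteriorAlgebra.ιMulti_zero_apply, ExteriorAlgebra.ιMulti_zero_apply,
      extForm_one]
    simp
  | n + 1, v, w => by
    rw [inner_ext, ExteriorAlgebra.ιMulti_succ_apply v, extForm_ι_mul, contract_ιMulti,
      ← inner_ext, inner_sum, Matrix.det_succ_row_zero]
    refine Finset.sum_congr rfl fun j _ => ?_
    rw [inner_smul_right, inner_ιMulti n]
    rfl

/-- Exterior products of different degrees are orthogonal. -/
theorem inner_ιMulti_of_ne : ∀ (n m : ℕ) (v : Fin n → K) (w : Fin m → K), n ≠ m →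
    inner ℂ (ExteriorAlgebra.ιMulti ℂ n v) (ExteriorAlgebra.ιMulti ℂ m w) = 0
  | 0, 0, _, _, h => absurd rfl h
  | 0, m + 1, v, w, _ => by
    rw [inner_ext, ExteriorAlgebra.ιMulti_zero_apply, ExteriorAlgebra.ιMulti_succ_apply,
      extForm_one, algebraMapInv_ι_mul]
  | n + 1, 0, v, w, _ => by
    rw [inner_ext, ExteriorAlgebra.ιMulti_zero_apply, ExteriorAlgebra.ιMulti_succ_apply,
      extForm_ι_mul, contract_one, extForm_zero_right]
  | n + 1, m + 1, v, w, h => by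
    rw [inner_ext, ExteriorAlgebra.ιMulti_succ_apply v, extForm_ι_mul, contract_ιMulti,
      ← inner_ext, inner_sum]
    refine Finset.sum_eq_zero fun j _ => ?_
    rw [inner_smul_right, inner_ιMulti_of_ne n m _ _ (by omega), mul_zero]

/-- The operator `(-1)^N` on the exterior algebra: the algebra automorphism with `f ↦ -f` on `K`,
which is `(-1)^n` on exterior products of `n` vectors. -/
def extParity : ExteriorAlgebra ℂ K →ₗ[ℂ] ExteriorAlgebra ℂ K :=
  (CliffordAlgebra.involute : ExteriorAlgebra ℂ K →ₐ[ℂ] ExteriorAlgebra ℂ K).toLinearMap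

theorem extParity_ι_mul (f : K) (x : ExteriorAlgebra ℂ K) :
    extParity (ExteriorAlgebra.ι ℂ f * x) = -(ExteriorAlgebra.ι ℂ f * extParity x) := by
  simp only [extParity, AlgHom.toLinearMap_apply, map_mul]
  rw [← neg_mul]
  congr 1
  exact CliffordAlgebra.involute_ι f

theorem extParity_algebraMap (r : ℂ) :
    extParity (algebraMap ℂ (ExteriorAlgebra ℂ K) r) = algebraMap ℂ _ r := by
  simp only [extParity, AlgHom.toLinearMap_apply]
  exact AlgHom.commutes _ r

theorem extParity_ιMulti : ∀ (n : ℕ) (v : Fin n → K),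
    extParity (ExteriorAlgebra.ιMulti ℂ n v) = (-1 : ℂ) ^ n • ExteriorAlgebra.ιMulti ℂ n v
  | 0, v => by
    rw [ExteriorAlgebra.ιMulti_zero_apply, ← map_one (algebraMap ℂ (ExteriorAlgebra ℂ K)),
      extParity_algebraMap, pow_zero, one_smul]
  | n + 1, v => by
    rw [ExteriorAlgebra.ιMulti_succ_apply, extParity_ι_mul, extParity_ιMulti n, mul_smul_comm,
      pow_succ, mul_neg_one, neg_smul]

theorem contract_extParity (h : K) (x : ExteriorAlgebra ℂ K) :
    contract h (extParity x) = -extParity (contract h x) := by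
  induction x using ext_induction with
  | h0 r => rw [extParity_algebraMap, contract_algebraMap, map_zero, neg_zero]
  | h1 x y hx hy => rw [map_add, map_add, map_add, map_add, hx, hy, neg_add]
  | h2 x f hx =>
    rw [extParity_ι_mul, map_neg, contract_ι_mul, contract_ι_mul, hx, map_sub, map_smul,
      extParity_ι_mul]
    simp only [mul_neg]

theorem inner_extParity (x : ExteriorAlgebra ℂ K) : ∀ y,
    inner ℂ (extParity x) (extParity y) = inner ℂ x y := by
  have h0 : ∀ y : ExteriorAlgebra ℂ K,
      ExteriorAlgebra.algebraMapInv (extParity y) = ExteriorAlgebra.algebraMapInv y := by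
    intro y
    induction y using ext_induction with
    | h0 r => rw [extParity_algebraMap]
    | h1 x y hx hy => rw [map_add, map_add, map_add, hx, hy]
    | h2 x f hx => rw [extParity_ι_mul, map_neg, algebraMapInv_ι_mul, algebraMapInv_ι_mul, neg_zero]
  induction x using ext_induction with
  | h0 r =>
    intro y
    rw [extParity_algebraMap, inner_ext, inner_ext, extForm_algebraMap, extForm_algebraMap, h0]
  | h1 x x' hx hx' => intro y; rw [map_add, inner_add_left, inner_add_left, hx, hx']
  | h2 x f hx =>
    intro y
    rw [extParity_ι_mul, inner_neg_left, inner_ext, inner_ext, extForm_ι_mul, extForm_ι_mul,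
      contract_extParity, ← inner_ext, ← inner_ext, inner_neg_right, neg_neg, hx]

theorem norm_extParity (x : ExteriorAlgebra ℂ K) : ‖extParity x‖ = ‖x‖ := by
  rw [@norm_eq_sqrt_re_inner ℂ, @norm_eq_sqrt_re_inner ℂ, inner_extParity]

variable (K) in
/-- The fermion Fock space `⊕ₙ ⋀ⁿ K` (Hilbert sum), as the completion of the exterior algebra. -/
abbrev Fock : Type _ := UniformSpace.Completion (ExteriorAlgebra ℂ K)

/-- The annihilation operator `α(h)`, whose adjoint is exterior multiplication by `h`. -/
def fockAnnihilate (h : K) : Fock K →L[ℂ] Fock K :=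
  ((contract h).mkContinuous ‖h‖ (norm_contract_le h)).completion

variable (K) in
/-- `(-1)^N` on Fock space, `N` the number operator. -/
def fockParity : Fock K →L[ℂ] Fock K :=
  (extParity.mkContinuous 1 fun x => by rw [norm_extParity, one_mul]).completion

variable (K) in
/-- The no-particle vector. -/
def fockVacuum : Fock K := ((1 : ExteriorAlgebra ℂ K) : Fock K)

variable (K) in
/-- The Hilbert space tensor product of two copies of Fock space. -/
abbrev FockPair : Type _ := UniformSpace.Completion (TensorProduct ℂ (Fock K) (Fock K))

variable (K) in
/-- The vacuum `Ω₀ ⊗ Ω₀`. -/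
def fockPairVacuum : FockPair K :=
  ((fockVacuum K ⊗ₜ[ℂ] fockVacuum K : TensorProduct ℂ (Fock K) (Fock K)) : FockPair K)

/-- The bounded operator `A ⊗ B`. -/
def tensorOp (A B : Fock K →L[ℂ] Fock K) : FockPair K →L[ℂ] FockPair K :=
  (TensorProduct.mapL A B).completion

/-- The particle annihilation operator `α(h) ⊗ I`. -/
def fockA (h : K) : FockPair K →L[ℂ] FockPair K :=
  tensorOp (fockAnnihilate h) (ContinuousLinearMap.id ℂ _)

/-- The antiparticle annihilation operator `(-1)^N ⊗ α(h)`. -/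
def fockB (h : K) : FockPair K →L[ℂ] FockPair K :=
  tensorOp (fockParity K) (fockAnnihilate h)

end

section

/-- Self-adjoint `4 × 4` Dirac matrices. -/
structure DiracMatrices where
  α : Fin 3 → Matrix (Fin 4) (Fin 4) ℂ
  β : Matrix (Fin 4) (Fin 4) ℂ
  α_herm : ∀ k, (α k).IsHermitian
  β_herm : β.IsHermitian
  α_anti : ∀ k l, α k * α l + α l * α k = if k = l then 2 else 0
  αβ_anti : ∀ k, α k * β + β * α k = 0
  β_sq : β * β = 1

/-- Position (and momentum) space `ℝ³`. -/
abbrev Position : Type := EuclideanSpace ℝ (Fin 3)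
/-- `ℂ⁴`. -/
abbrev Spinor : Type := EuclideanSpace ℂ (Fin 4)
/-- `L²(ℝ³, ℂ⁴)`. -/
abbrev OneParticle : Type := Lp Spinor 2 (volume : Measure Position)

/-- The operator `f ↦ 𝓕⁻¹ (p ↦ T(p) (𝓕 f)(p))` on `L²(ℝ³, ℂ⁴)`, for a bounded measurable `T`. -/
def fourierMultiplier (T : Position → Spinor →L[ℂ] Spinor) (hT : MemLp T ∞ volume) :
    OneParticle →L[ℂ] OneParticle :=
  let F := (Lp.fourierTransformₗᵢ Position Spinor)
  F.symm.toContinuousLinearEquiv.toContinuousLinearMap ∘L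
    ((ContinuousLinearMap.id ℂ (Spinor →L[ℂ] Spinor)).holderL volume ∞ 2 2 (hT.toLp T)) ∘L
      F.toContinuousLinearEquiv.toContinuousLinearMap

variable (D : DiracMatrices) (m : ℝ)

/-- The Dirac Hamiltonian in momentum space, `∑ₖ 2π pₖ αᵏ + m β`; with the Fourier transform
`∫ exp(-2πi p·x) f(x) dx` the operator `-i ∂ₖ` is multiplication by `2π pₖ`. -/
def DiracMatrices.symbolMatrix (p : Position) : Matrix (Fin 4) (Fin 4) ℂ :=
  (∑ k, ((2 * Real.pi * p k : ℝ) : ℂ) • D.α k) + (m : ℂ) • D.β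

/-- The momentum space Hamiltonian as an operator on `ℂ⁴`. -/
def DiracMatrices.symbol (p : Position) : Spinor →L[ℂ] Spinor :=
  Matrix.toEuclideanCLM (𝕜 := ℂ) (D.symbolMatrix m p)

/-- `ω = √(-Δ + m²)` in momentum space. -/
def energy (p : Position) : ℝ := √((2 * Real.pi * ‖p‖) ^ 2 + m ^ 2)

/-- `(ω + σ H) / (2 ω)` in momentum space, for a sign `σ = ±1`. -/
def DiracMatrices.projSymbol (σ : ℤˣ) (p : Position) : Spinor →L[ℂ] Spinor :=
  (2⁻¹ : ℂ) • (1 + (((σ : ℤ) : ℂ) * ((energy m p : ℝ) : ℂ)⁻¹) • D.symbol m p)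

/-- `exp(i t H)` in momentum space. -/
def DiracMatrices.evolSymbol (t : ℝ) (p : Position) : Spinor →L[ℂ] Spinor :=
  NormedSpace.exp ((Complex.I * t) • D.symbol m p)

open LineDeriv SchwartzMap in
/-- The Dirac Hamiltonian `-i ∇·α + βm` on Schwartz functions. -/
def DiracMatrices.hamiltonian (f : 𝓢(Position, Spinor)) : 𝓢(Position, Spinor) :=
  (-Complex.I) • (∑ k, (∂_{(EuclideanSpace.single k (1 : ℝ) : Position)} f).postcompCLM
      (Matrix.toEuclideanCLM (𝕜 := ℂ) (D.α k))) +
    (m : ℂ) • f.postcompCLM (Matrix.toEuclideanCLM (𝕜 := ℂ) D.β)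

open SchwartzMap in
theorem fourier_postcomp (L : Spinor →L[ℂ] Spinor) (f : 𝓢(Position, Spinor)) :
    𝓕 (f.postcompCLM L) = (𝓕 f).postcompCLM L := by
  ext1 p
  rw [postcompCLM_apply, fourier_coe, fourier_coe, Real.fourier_eq, Real.fourier_eq,
    ← L.integral_comp_comm]
  · refine integral_congr_ae (Filter.Eventually.of_forall fun x => ?_)
    simp only [postcompCLM_apply, Circle.smul_def, map_smul]
  · exact (Real.fourierIntegral_convergent_iff p).2 f.integrable

open LineDeriv SchwartzMap in
/-- The Fourier transform turns the Dirac Hamiltonian into multiplication by its symbol. -/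
theorem DiracMatrices.fourier_hamiltonian (f : 𝓢(Position, Spinor)) (p : Position) :
    𝓕 (D.hamiltonian m f) p = D.symbol m p (𝓕 f p) := by
  have hF : ∀ g : 𝓢(Position, Spinor), 𝓕 g = FourierTransform.fourierCLM ℂ 𝓢(Position, Spinor) g :=
    fun g => rfl
  rw [hamiltonian, hF, map_add, map_smul, map_smul, map_sum]
  simp only [← hF, fourier_postcomp, fourier_lineDerivOp_eq, symbol, symbolMatrix, map_add, map_sum,
    map_smul]
  have ht : ∀ k, (fun x : Position =>
    inner ℝ x (EuclideanSpace.single k (1 : ℝ))).HasTemperateGrowth :=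
      fun k => ((innerSL ℝ).flip (EuclideanSpace.single k (1 : ℝ) : Position)).hasTemperateGrowth
  simp [ht, Fin.sum_univ_three]
  have hx : ∀ (k : Fin 3) (v : Spinor), -(Complex.I • (2 * (Real.pi : ℂ) * Complex.I) •
      (inner ℝ p (EuclideanSpace.single k (1 : ℝ)) : ℝ) • v) = (2 * (Real.pi : ℂ) * (p k : ℂ)) • v := by
    intro k v
    rw [EuclideanSpace.inner_single_right, ← Complex.coe_smul, smul_smul, smul_smul, ← neg_smul]
    congr 1
    simp
    linear_combination (-2 * (Real.pi : ℂ) * (p k : ℂ)) * Complex.I_mul_I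
  rw [hx, hx, hx]

theorem DiracMatrices.symbolMatrix_sq (p : Position) :
    D.symbolMatrix m p * D.symbolMatrix m p = (((energy m p) ^ 2 : ℝ) : ℂ) • 1 := by
  have h00 := D.α_anti 0 0
  have h11 := D.α_anti 1 1
  have h22 := D.α_anti 2 2
  have h01 := D.α_anti 0 1
  have h02 := D.α_anti 0 2
  have h12 := D.α_anti 1 2
  have b0 := D.αβ_anti 0
  have b1 := D.αβ_anti 1
  have b2 := D.αβ_anti 2
  have bb := D.β_sq
  have hE : (energy m p) ^ 2 =
      (2 * Real.pi * p 0) ^ 2 + (2 * Real.pi * p 1) ^ 2 + (2 * Real.pi * p 2) ^ 2 + m ^ 2 := by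
    rw [energy, Real.sq_sqrt (by positivity), mul_pow, EuclideanSpace.norm_sq_eq]
    simp [Fin.sum_univ_three]
    ring
  rw [hE]
  simp only [Fin.isValue, if_true, show (0 : Fin 3) ≠ 1 by decide, show (0 : Fin 3) ≠ 2 by decide,
    show (1 : Fin 3) ≠ 2 by decide, if_false] at *
  simp only [symbolMatrix, Fin.sum_univ_three]
  generalize ((2 * Real.pi * p 0 : ℝ)) = x
  generalize ((2 * Real.pi * p 1 : ℝ)) = y
  generalize ((2 * Real.pi * p 2 : ℝ)) = z
  generalize D.α 0 = A at *
  generalize D.α 1 = B at *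
  generalize D.α 2 = C at *
  generalize D.β = E at *
  have two : ∀ M : Matrix (Fin 4) (Fin 4) ℂ, M + M = 2 → M = 1 := by
    intro M h
    have : (2 : ℂ) • M = (2 : ℂ) • 1 := by
      rw [two_smul, two_smul, h, one_add_one_eq_two]
    exact smul_right_injective _ (two_ne_zero) this
  have h00 := two _ h00
  have h11 := two _ h11
  have h22 := two _ h22
  rw [add_comm, ← eq_neg_iff_add_eq_zero] at h01 h02 h12 b0 b1 b2
  simp only [add_mul, mul_add, smul_mul_assoc, mul_smul_comm, h00, h11, h22, h01, h02, h12, b0, b1,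
    b2, bb]
  push_cast
  module

theorem DiracMatrices.symbol_selfAdjoint (p : Position) : IsSelfAdjoint (D.symbol m p) := by
  rw [symbol, IsSelfAdjoint, ← map_star]
  congr 1
  rw [symbolMatrix, Matrix.star_eq_conjTranspose]
  simp [Matrix.conjTranspose_sum, (D.α_herm _).eq, D.β_herm.eq, -Complex.ofReal_mul]

theorem DiracMatrices.norm_symbol (p : Position) : ‖D.symbol m p‖ = energy m p := by
  have h : ‖D.symbol m p‖ ^ 2 = energy m p ^ 2 := by
    rw [pow_two, ← CStarRing.norm_self_mul_star, (D.symbol_selfAdjoint m p).star_eq, symbol, ← map_mul,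
      symbolMatrix_sq, map_smul, map_one, norm_smul, norm_one, Complex.norm_real]
    simp
  exact (sq_eq_sq₀ (norm_nonneg _) (Real.sqrt_nonneg _)).1 h

theorem DiracMatrices.continuous_symbol : Continuous (D.symbol m) := by
  have : Continuous (D.symbolMatrix m) := by
    unfold symbolMatrix
    fun_prop
  exact (LinearMap.continuous_of_finiteDimensional
    (Matrix.toEuclideanCLM (𝕜 := ℂ) (n := Fin 4)).toAlgEquiv.toLinearMap).comp this

theorem continuous_energy : Continuous (energy m) := by
  unfold energy
  fun_prop

theorem DiracMatrices.memLp_projSymbol (σ : ℤˣ) : MemLp (D.projSymbol m σ) ∞ volume := by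
  have hmeas : AEStronglyMeasurable (D.projSymbol m σ) volume := by
    have hc : Measurable fun p => ((σ : ℤ) : ℂ) * ((energy m p : ℝ) : ℂ)⁻¹ := by
      have : Measurable (energy m) := (continuous_energy m).measurable
      fun_prop
    have h1 : AEStronglyMeasurable
        (fun p => (((σ : ℤ) : ℂ) * ((energy m p : ℝ) : ℂ)⁻¹) • D.symbol m p) volume :=
      hc.aestronglyMeasurable.smul (D.continuous_symbol m).aestronglyMeasurable
    have h2 : AEStronglyMeasurable (fun _ : Position => (1 : Spinor →L[ℂ] Spinor)) volume :=
      aestronglyMeasurable_const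
    exact (h2.add h1).const_smul (2⁻¹ : ℂ)
  refine memLp_top_of_bound hmeas 1 (Filter.Eventually.of_forall fun p => ?_)
  rw [projSymbol, norm_smul]
  have h1 : ‖(((σ : ℤ) : ℂ) * ((energy m p : ℝ) : ℂ)⁻¹) • D.symbol m p‖ ≤ 1 := by
    rw [norm_smul, D.norm_symbol, norm_mul, norm_inv, Complex.norm_real,
      Real.norm_of_nonneg (show 0 ≤ energy m p from Real.sqrt_nonneg _)]
    have : ‖((σ : ℤ) : ℂ)‖ = 1 := by rcases Int.units_eq_one_or σ with h | h <;> simp [h]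
    rw [this, one_mul]
    exact inv_mul_le_one
  have h2 := norm_add_le (1 : Spinor →L[ℂ] Spinor)
    ((((σ : ℤ) : ℂ) * ((energy m p : ℝ) : ℂ)⁻¹) • D.symbol m p)
  rw [norm_one] at h2
  have h3 : ‖(2⁻¹ : ℂ)‖ = 2⁻¹ := by simp
  rw [h3]
  linarith

theorem DiracMatrices.memLp_evolSymbol (t : ℝ) : MemLp (D.evolSymbol m t) ∞ volume := by
  have hc : Continuous (D.evolSymbol m t) := by
    unfold evolSymbol
    let _ : NormedAlgebra ℚ (Spinor →L[ℂ] Spinor) := .restrictScalars ℚ ℂ _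
    exact NormedSpace.exp_continuous.comp ((D.continuous_symbol m).const_smul (Complex.I * t))
  refine memLp_top_of_bound hc.aestronglyMeasurable 1 (Filter.Eventually.of_forall fun p => ?_)
  have hs : IsSelfAdjoint ((t : ℂ) • D.symbol m p) :=
    IsSelfAdjoint.smul (Complex.conj_ofReal t) (D.symbol_selfAdjoint m p)
  have := (selfAdjoint.expUnitary ⟨(t : ℂ) • D.symbol m p, selfAdjoint.mem_iff.2 hs⟩).2
  have h := CStarRing.norm_of_mem_unitary this
  rw [selfAdjoint.expUnitary_coe, smul_smul] at h
  exact h.le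

/-- The projection `P^σ = (ω + σ H) / (2 ω)` onto the states of positive (`σ = 1`) or negative
(`σ = -1`) energy. -/
def diracProj (σ : ℤˣ) : OneParticle →L[ℂ] OneParticle :=
  fourierMultiplier (D.projSymbol m σ) (D.memLp_projSymbol m σ)

/-- The unitary `exp(i t H)`. -/
def diracEvol (t : ℝ) : OneParticle →L[ℂ] OneParticle :=
  fourierMultiplier (D.evolSymbol m t) (D.memLp_evolSymbol m t)

/-- `ℋ⁺` (`σ = 1`) or `ℋ⁻` (`σ = -1`). -/
def energySpace (σ : ℤˣ) : Submodule ℂ OneParticle := LinearMap.range (diracProj D m σ).toLinearMap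

theorem diracProj_mem (σ : ℤˣ) (f : OneParticle) : diracProj D m σ f ∈ energySpace D m σ := ⟨f, rfl⟩

/-- The orthonormal basis `(eᵢ)` is compatible with the splitting: `eᵢ ∈ ℋ⁺` for `i > 0` and
`eᵢ ∈ ℋ⁻` for `i < 0`. -/
def IsCompatibleBasis (e : HilbertBasis NZ ℂ OneParticle) : Prop :=
  ∀ i : NZ, (0 < i.1 → e i ∈ energySpace D m 1) ∧ (i.1 < 0 → e i ∈ energySpace D m (-1))

/-- `C` (an antilinear map) is a charge conjugation. -/
structure IsChargeConjugation (C : OneParticle →ₛₗ[starRingEnd ℂ] OneParticle) : Prop where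
  involutive : ∀ f, C (C f) = f
  inner_map : ∀ f g, inner ℂ (C f) (C g) = inner ℂ g f
  map_proj : ∀ (σ : ℤˣ) (f : OneParticle), C (diracProj D m σ f) = diracProj D m (-σ) (C f)

variable {D m}

theorem IsChargeConjugation.map_neg_mem {C : OneParticle →ₛₗ[starRingEnd ℂ] OneParticle}
    (hC : IsChargeConjugation D m C) (f : OneParticle) :
    C (diracProj D m (-1) f) ∈ energySpace D m 1 := by
  rw [hC.map_proj, neg_neg]
  exact diracProj_mem D m 1 _

/-- The particle annihilation operator `a(h) = ψ(h)` of the Dirac sea. -/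
def seaA (e : HilbertBasis NZ ℂ OneParticle) (h : energySpace D m 1) : SeaSpace →L[ℂ] SeaSpace :=
  psi e (h : OneParticle)

/-- The antiparticle annihilation operator `b(h) = ψ*(C h)` of the Dirac sea. -/
def seaB (e : HilbertBasis NZ ℂ OneParticle) (C : OneParticle →ₛₗ[starRingEnd ℂ] OneParticle)
    (h : energySpace D m 1) : SeaSpace →L[ℂ] SeaSpace :=
  psiStar e (C (h : OneParticle))

variable (D m)

/-- The Dirac field `ψ(t, f) = ψ(exp(i t H) f)` on the Dirac sea. -/
def seaField (e : HilbertBasis NZ ℂ OneParticle) (t : ℝ) (f : OneParticle) :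
    SeaSpace →L[ℂ] SeaSpace :=
  psi e (diracEvol D m t f)

variable {D m}

/-- The time zero Dirac field `ψ(f) = a(P⁺ f) + b*(C P⁻ f)` on Fock space. -/
def fockFieldZero {C : OneParticle →ₛₗ[starRingEnd ℂ] OneParticle}
    (hC : IsChargeConjugation D m C) (f : OneParticle) :
    FockPair (energySpace D m 1) →L[ℂ] FockPair (energySpace D m 1) :=
  fockA ⟨diracProj D m 1 f, diracProj_mem D m 1 f⟩ +
    (fockB ⟨C (diracProj D m (-1) f), hC.map_neg_mem f⟩).adjoint

/-- The Dirac field `ψ(t, f) = ψ(exp(i t H) f)` on Fock space. -/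
def fockField {C : OneParticle →ₛₗ[starRingEnd ℂ] OneParticle}
    (hC : IsChargeConjugation D m C) (t : ℝ) (f : OneParticle) :
    FockPair (energySpace D m 1) →L[ℂ] FockPair (energySpace D m 1) :=
  fockFieldZero hC (diracEvol D m t f)

end

end DiracSea

end

open DiracSea

/-!
The Dirac sea and the Fock space carry the same representation of the canonical anticommutation
relations, and such a representation with a cyclic vacuum vector is unique up to unitary
equivalence.

In detail, let `V` be an inner product space and let creation operators `cre f`, `f ∈ V`, on a
Hilbert space satisfy the anticommutation relations, with a unit vector `vac` that all the
adjoints annihilate. Then `x ↦ cre x vac` is defined on the exterior algebra of `V`, the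
annihilation operators act on its values as contractions, and so it preserves inner products
(`FockRep.inner_state`). If the vacuum is cyclic it has dense range, so that any two such
representations are identified by extending the identity of the exterior algebra
(`FockRep.exists_unitary`).

This is applied to `V = ℋ⁺ ⊕ ℋ⁺`, particles and antiparticles. On the tensor square of the Fock
space the sign `(-1)^N` makes the two families anticommute (`FockRep.fockPair`). On the Dirac
sea the relations of the `ψ(eᵢ)` and `ψ*(eⱼ)` are checked on the basis vectors `e_I`; they imply
`‖∑ cᵢ ψ(eᵢ)‖² ≤ ∑ |cᵢ|²` for finite sums, hence the convergence of the series for `ψ(f)` and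
`ψ*(f) = ψ(f)†` and the relations for all `f`. The sea vector is cyclic because each `e_I`
differs from it by finitely many particles and antiparticles (`sea_cyclic`), and it is
annihilated by `ψ(h)` and `ψ*(C h)`, `h ∈ ℋ⁺`, because `ℋ⁺` and `ℋ⁻` are orthogonal
(`FockRep.sea`). The statement about the fields follows from `ψ(f) = a(P⁺ f) + b(C P⁻ f)†`,
which also holds on the Dirac sea.

A compatible basis exists because `ℋ⁺` and `ℋ⁻` are closed, separable and of infinite dimension:
the constant matrix `α¹ α² α³ β` anticommutes with the Dirac operator and therefore exchanges
`ℋ⁺` and `ℋ⁻`, whose sum is infinite-dimensional. Given such a basis, the antilinear map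
`eᵢ ↦ e₋ᵢ` is a charge conjugation.
-/

noncomputable section

namespace DiracSea

/-! ### Cyclic vacuum representations of the canonical anticommutation relations -/

/-- A representation of the canonical anticommutation relations over `V` by bounded operators on the
Hilbert space `X`, with a cyclic vacuum vector. The linear map `cre` gives the creation operators;
the annihilation operators are their adjoints. Cyclicity says that a closed subspace that contains
the vacuum and is stable under the creation operators is everything. -/
structure FockRep (V X : Type*) [NormedAddCommGroup V] [InnerProductSpace ℂ V]
    [NormedAddCommGroup X] [InnerProductSpace ℂ X] [CompleteSpace X] where
  cre : V →ₗ[ℂ] X →L[ℂ] X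
  vac : X
  cre_cre : ∀ f x, cre f (cre f x) = 0
  anticomm : ∀ f g x, (cre f).adjoint (cre g x) + cre g ((cre f).adjoint x) = inner ℂ f g • x
  ann_vac : ∀ f, (cre f).adjoint vac = 0
  norm_vac : ‖vac‖ = 1
  cyclic : ∀ S : Submodule ℂ X, IsClosed (S : Set X) → vac ∈ S →
    (∀ f, ∀ x ∈ S, cre f x ∈ S) → S = ⊤

namespace FockRep

variable {V X Y : Type*} [NormedAddCommGroup V] [InnerProductSpace ℂ V]
  [NormedAddCommGroup X] [InnerProductSpace ℂ X] [CompleteSpace X]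
  [NormedAddCommGroup Y] [InnerProductSpace ℂ Y] [CompleteSpace Y]

/-- The homomorphism `f₁ ∧ … ∧ fₙ ↦ cre f₁ ∘ … ∘ cre fₙ`. -/
def creHom (R : FockRep V X) : ExteriorAlgebra ℂ V →ₐ[ℂ] X →L[ℂ] X :=
  ExteriorAlgebra.lift ℂ ⟨R.cre, fun f => ContinuousLinearMap.ext (R.cre_cre f)⟩

/-- The map `f₁ ∧ … ∧ fₙ ↦ cre f₁ … cre fₙ vac` from the exterior algebra to the representation
space. -/
def state (R : FockRep V X) : ExteriorAlgebra ℂ V →ₗ[ℂ] X where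
  toFun x := R.creHom x R.vac
  map_add' x y := by simp
  map_smul' c x := by simp

variable (R : FockRep V X)

theorem state_algebraMap (r : ℂ) : R.state (algebraMap ℂ _ r) = r • R.vac := by
  simp [state, Algebra.algebraMap_eq_smul_one]

theorem state_one : R.state 1 = R.vac := by
  simp [state]

theorem state_ι_mul (f : V) (x : ExteriorAlgebra ℂ V) :
    R.state (ExteriorAlgebra.ι ℂ f * x) = R.cre f (R.state x) := by
  simp [state, creHom]

/-- By the anticommutation relations an annihilation operator acts on the states as contraction. -/
theorem adjoint_cre_state (f : V) (x : ExteriorAlgebra ℂ V) :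
    (R.cre f).adjoint (R.state x) = R.state (contract f x) := by
  induction x using ext_induction with
  | h0 r => simp [state_algebraMap, contract_algebraMap, R.ann_vac]
  | h1 x y hx hy => simp only [map_add, hx, hy]
  | h2 x g hx =>
    rw [state_ι_mul, contract_ι_mul, map_sub, map_smul, state_ι_mul, ← hx, ← R.anticomm f g,
      add_sub_cancel_right]

/-- The inner products of states are determined by the anticommutation relations. -/
theorem inner_state (x : ExteriorAlgebra ℂ V) : ∀ y,
    inner ℂ (R.state x) (R.state y) = inner ℂ x y := by
  have h1 : ∀ y : ExteriorAlgebra ℂ V,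
      inner ℂ R.vac (R.state y) = ExteriorAlgebra.algebraMapInv y := by
    intro y
    induction y using ext_induction with
    | h0 r =>
      rw [state_algebraMap, inner_smul_right, inner_self_eq_norm_sq_to_K, R.norm_vac]
      simp [ExteriorAlgebra.algebraMapInv]
    | h1 x y hx hy => rw [map_add, inner_add_right, hx, hy, map_add]
    | h2 x f hx =>
      rw [state_ι_mul, ← ContinuousLinearMap.adjoint_inner_left, R.ann_vac, inner_zero_left,
        algebraMapInv_ι_mul]
  induction x using ext_induction with
  | h0 r =>
    intro y
    rw [state_algebraMap, inner_smul_left, h1, inner_ext, extForm_algebraMap]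
  | h1 x x' hx hx' => intro y; rw [map_add, inner_add_left, inner_add_left, hx, hx']
  | h2 x f hx =>
    intro y
    rw [state_ι_mul, ← ContinuousLinearMap.adjoint_inner_right, adjoint_cre_state, hx, inner_ext,
      inner_ext, extForm_ι_mul]

theorem norm_state (x : ExteriorAlgebra ℂ V) : ‖R.state x‖ = ‖x‖ := by
  rw [@norm_eq_sqrt_re_inner ℂ, @norm_eq_sqrt_re_inner ℂ, inner_state]

theorem denseRange_state : DenseRange R.state := by
  have h := R.cyclic R.state.range.topologicalClosure
    (Submodule.isClosed_topologicalClosure _)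
    (Submodule.le_topologicalClosure _ ⟨1, R.state_one⟩) fun f x hx => by
      refine map_mem_closure (R.cre f).continuous hx ?_
      rintro _ ⟨y, rfl⟩
      exact ⟨_, R.state_ι_mul f y⟩
  rw [DenseRange, ← LinearMap.coe_range]
  exact Submodule.dense_iff_topologicalClosure_eq_top.2 h

/-- Two cyclic vacuum representations over the same space are unitarily equivalent. -/
theorem exists_unitary (R : FockRep V X) (R' : FockRep V Y) :
    ∃ U : X ≃ₗᵢ[ℂ] Y, U R.vac = R'.vac ∧
      ∀ f x, U ((R.cre f).adjoint x) = (R'.cre f).adjoint (U x) := by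
  let U := (LinearEquiv.refl ℂ (ExteriorAlgebra ℂ V)).extendOfIsometry R.state R'.state
    R.denseRange_state R'.denseRange_state fun x => by
      rw [LinearEquiv.refl_apply, norm_state, norm_state]
  have hU : ∀ x, U (R.state x) = R'.state x := fun x =>
    LinearEquiv.extendOfIsometry_eq _ _ _ _ _ _ x
  refine ⟨U, by rw [← state_one, ← state_one, hU], fun f => ?_⟩
  refine fun x => R.denseRange_state.induction_on x ?_ fun y => ?_
  · exact isClosed_eq (by fun_prop) (by fun_prop)
  · rw [adjoint_cre_state, hU, hU, adjoint_cre_state]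

end FockRep

/-! ### Anticommutation relations on the Dirac sea -/

namespace SeaSeq

/-- A sea sequence is determined by the set of its entries. -/
theorem ext_has {I J : SeaSeq} (h : ∀ j, I.Has j ↔ J.Has j) : I = J := by
  have hI : StrictMono fun k => OrderDual.toDual (I.seq k) := fun _ _ hab => I.seq_strictAnti hab
  have hJ : StrictMono fun k => OrderDual.toDual (J.seq k) := fun _ _ hab => J.seq_strictAnti hab
  have : (fun k => OrderDual.toDual (I.seq k)) = fun k => OrderDual.toDual (J.seq k) :=
    (hI.range_inj hJ).1 (Set.ext fun j => h (OrderDual.ofDual j))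
  exact SeaSeq.ext (funext fun k => OrderDual.toDual.injective (congrFun this k))

theorem has_erase (I : SeaSeq) {i : ℤ} (hi : I.Has i) (j : ℤ) :
    (I.erase (I.pos i)).Has j ↔ I.Has j ∧ j ≠ i := by
  have hi' := (I.has_iff i).1 hi
  constructor
  · rintro ⟨k, hk⟩
    simp only [erase] at hk
    split_ifs at hk with h
    · have := I.lt_seq i h
      exact ⟨⟨_, hk⟩, by omega⟩
    · have := I.seq_strictAnti (show I.pos i < k + 1 by omega)
      exact ⟨⟨_, hk⟩, by omega⟩
  · rintro ⟨⟨k, hk⟩, hji⟩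
    rcases lt_trichotomy k (I.pos i) with h | h | h
    · exact ⟨k, by simp only [erase, if_pos h]; exact hk⟩
    · exact absurd (by rw [← hk, h, hi']) hji
    · refine ⟨k - 1, ?_⟩
      simp only [erase]
      rw [if_neg (by omega), Nat.sub_add_cancel (by omega)]
      exact hk

theorem pos_erase (I : SeaSeq) {i : ℤ} (hi : I.Has i) (j : ℤ) :
    I.pos j = (I.erase (I.pos i)).pos j + if j < i then 1 else 0 := by
  have hi' := (I.has_iff i).1 hi
  set p := I.pos i
  set J := I.erase p
  have h1 := J.seq_pos_le j
  have h2 : ∀ k < J.pos j, j < J.seq k := fun k hk => J.lt_seq j hk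
  have hJ : ∀ k, J.seq k = if k < p then I.seq k else I.seq (k + 1) := fun k => rfl
  rw [hJ] at h1
  split_ifs with hji
  · have hp : p ≤ J.pos j := by
      by_contra! h
      rw [if_pos h] at h1
      have := I.seq_strictAnti h
      omega
    rw [if_neg (by omega)] at h1
    refine I.pos_eq _ _ h1 fun k hk => ?_
    rcases lt_trichotomy k p with h | h | h
    · have := h2 k (by omega)
      rwa [hJ, if_pos h] at this
    · rw [h, hi']; exact hji
    · have := h2 (k - 1) (by omega)
      rwa [hJ, if_neg (by omega), Nat.sub_add_cancel (by omega)] at this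
  · have hp : J.pos j ≤ p := by
      by_contra! h
      have := h2 p h
      rw [hJ, if_neg (by omega)] at this
      have := I.anti p
      omega
    refine I.pos_eq _ _ ?_ fun k hk => ?_
    · rcases hp.lt_or_eq with h | h
      · rwa [if_pos h] at h1
      · rw [add_zero, h, hi']; omega
    · have := h2 k hk
      rwa [hJ, if_pos (by omega)] at this

theorem has_insert (I : SeaSeq) (i : NZ) (hi : ¬ I.Has i) (j : ℤ) :
    (I.insert i hi).Has j ↔ I.Has j ∨ j = i := by
  have h := (I.insert i hi).has_erase (I.insert_has i hi) j
  rw [insert_pos, erase_insert] at h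
  by_cases hj : j = i
  · subst hj; simp [I.insert_has i hi]
  · simp [h, hj]

theorem pos_insert (I : SeaSeq) (i : NZ) (hi : ¬ I.Has i) (j : ℤ) :
    (I.insert i hi).pos j = I.pos j + if j < i then 1 else 0 := by
  have h := (I.insert i hi).pos_erase (I.insert_has i hi) j
  rwa [insert_pos, erase_insert] at h

theorem has_sea (j : ℤ) : sea.Has j ↔ j < 0 := by
  constructor
  · rintro ⟨k, rfl⟩
    simp only [sea]
    omega
  · intro h
    exact ⟨(-j - 1).toNat, by simp only [sea]; omega⟩

end SeaSeq

/-- Bounded operators on the sea space agree if they agree on the basis vectors `e_I`. -/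
theorem sea_ext {X : Type*} [NormedAddCommGroup X] [NormedSpace ℂ X] {A B : SeaSpace →L[ℂ] X}
    (h : ∀ I, A (seaVec I) = B (seaVec I)) : A = B := by
  classical
  refine lp.ext_continuousLinearMap (by norm_num) fun I => ContinuousLinearMap.ext_ring ?_
  change A (lp.single 2 I (1 : ℂ)) = B (lp.single 2 I (1 : ℂ))
  have := h I
  rw [seaVec] at this
  convert this

/-- The adjoint of a signed shift is the signed shift along the inverse partial bijection. -/
theorem inner_signedShift {ι : Type*} (σ : ι ≃. ι) (ε : ι → ℤˣ) (ε' : ι → ℤˣ)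
    (h : ∀ I J, σ I = some J → ε I = ε' J) (Φ Ψ : lp (fun _ : ι => ℂ) 2) :
    inner ℂ (signedShift σ ε Φ) Ψ = inner ℂ Φ (signedShift σ.symm ε' Ψ) := by
  classical
  have key : ∀ I : ι, inner ℂ (signedShift σ ε (lp.single 2 I 1)) Ψ =
      inner ℂ (lp.single 2 I (1 : ℂ)) (signedShift σ.symm ε' Ψ) := by
    intro I
    rw [signedShift_single, lp.inner_single_left]
    change _ = inner ℂ (1 : ℂ) ((σ I).elim 0 fun J => ((ε' J : ℤ) : ℂ) * Ψ J)
    cases hI : σ I with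
    | none => simp
    | some J =>
      simp only [Option.elim_some]
      rw [inner_smul_left, lp.inner_single_left, h I J hI]
      simp [mul_comm]
  have : (innerSL ℂ Ψ).comp (signedShift σ ε) = innerSL ℂ (signedShift σ.symm ε' Ψ) := by
    refine lp.ext_continuousLinearMap (by norm_num) fun I => ContinuousLinearMap.ext_ring ?_
    have := congrArg (starRingEnd ℂ) (key I)
    rw [inner_conj_symm, inner_conj_symm] at this
    exact this
  have := congrArg (starRingEnd ℂ) (DFunLike.congr_fun this Φ)
  simp only [ContinuousLinearMap.comp_apply, innerSL_apply_apply, inner_conj_symm] at this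
  exact this

theorem adjoint_psiBasis (j : NZ) : (psiBasis j).adjoint = psiStarBasis j := by
  refine Eq.symm ((ContinuousLinearMap.eq_adjoint_iff _ _).2 fun Φ Ψ => ?_)
  rw [← inner_conj_symm, ← inner_conj_symm Φ]
  congr 1
  refine (inner_signedShift (SeaSeq.remove j) (fun I => (-1) ^ I.pos j) (fun I => (-1) ^ I.pos j)
    (fun I J h => ?_) _ _).symm
  by_cases hI : I.Has j
  · have h : I.erase (I.pos j) = J := by simpa [SeaSeq.remove, hI] using h
    rw [← h, I.erase_pos j hI]
  · simp [SeaSeq.remove, hI] at h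

theorem neg_one_pow_mul_add_eq_zero {a b c d : ℕ} (h : a + b = c + d + 1 ∨ a + b + 1 = c + d) :
    (-1 : ℂ) ^ a * (-1) ^ b + (-1) ^ c * (-1) ^ d = 0 := by
  rw [← pow_add, ← pow_add]
  rcases h with h | h
  · rw [h, pow_succ]; ring
  · rw [← h, pow_succ]; ring

theorem psiBasis_psiBasis (i j : NZ) : psiBasis i * psiBasis j + psiBasis j * psiBasis i = 0 := by
  refine sea_ext fun I => ?_
  simp only [add_apply, mul_apply_eq_comp, zero_apply]
  rcases eq_or_ne i j with rfl | hij
  · by_cases hi : I.Has i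
    · rw [psiBasis_of_has _ _ hi, map_smul, psiBasis_of_not_has _ _ (I.erase_not_has i hi)]
      simp
    · rw [psiBasis_of_not_has _ _ hi]
      simp
  have hij' : (i : ℤ) ≠ j := fun h => hij (Subtype.ext h)
  by_cases hi : I.Has i <;> by_cases hj : I.Has j
  · have hij1 : (I.erase (I.pos i)).Has j := (I.has_erase hi j).2 ⟨hj, hij'.symm⟩
    have hji1 : (I.erase (I.pos j)).Has i := (I.has_erase hj i).2 ⟨hi, hij'⟩
    rw [psiBasis_of_has _ _ hi, psiBasis_of_has _ _ hj, map_smul, map_smul,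
      psiBasis_of_has _ _ hij1, psiBasis_of_has _ _ hji1]
    have e : (I.erase (I.pos i)).erase ((I.erase (I.pos i)).pos j) =
        (I.erase (I.pos j)).erase ((I.erase (I.pos j)).pos i) := by
      refine SeaSeq.ext_has fun k => ?_
      rw [SeaSeq.has_erase _ hij1, SeaSeq.has_erase _ hji1, SeaSeq.has_erase _ hi,
        SeaSeq.has_erase _ hj]
      tauto
    rw [e, smul_smul, smul_smul, ← add_smul]
    have p1 := I.pos_erase hi j
    have p2 := I.pos_erase hj i
    rw [neg_one_pow_mul_add_eq_zero, zero_smul]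
    split_ifs at p1 p2 <;> omega
  · rw [psiBasis_of_has _ _ hi, psiBasis_of_not_has _ _ hj, map_smul, psiBasis_of_not_has j]
    · simp
    · exact fun h => hj ((I.has_erase hi j).1 h).1
  · rw [psiBasis_of_has _ _ hj, psiBasis_of_not_has _ _ hi, map_smul, psiBasis_of_not_has i]
    · simp
    · exact fun h => hi ((I.has_erase hj i).1 h).1
  · rw [psiBasis_of_not_has _ _ hj, psiBasis_of_not_has _ _ hi]
    simp

theorem psiBasis_psiStarBasis (i j : NZ) :
    psiBasis i * psiStarBasis j + psiStarBasis j * psiBasis i =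
      (if i = j then 1 else 0 : ℂ) • 1 := by
  refine sea_ext fun I => ?_
  simp only [add_apply, mul_apply_eq_comp, smul_apply,
    one_apply_eq_self]
  rcases eq_or_ne i j with rfl | hij
  · by_cases hi : I.Has i
    · rw [psiBasis_of_has _ _ hi, map_smul, psiStarBasis_of_has _ _ hi,
        psiStarBasis_of_not_has _ _ (I.erase_not_has i hi), I.insert_erase i hi, I.erase_pos i hi,
        smul_smul, ← mul_pow]
      simp
    · rw [psiBasis_of_not_has _ _ hi, psiStarBasis_of_not_has _ _ hi, map_smul,
        psiBasis_of_has _ _ (I.insert_has i hi), I.insert_pos i hi, I.erase_insert i hi,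
        smul_smul, ← mul_pow]
      simp
  have hij' : (i : ℤ) ≠ j := fun h => hij (Subtype.ext h)
  rw [if_neg hij, zero_smul]
  by_cases hj : I.Has j
  · rw [psiStarBasis_of_has _ _ hj, map_zero, zero_add]
    by_cases hi : I.Has i
    · rw [psiBasis_of_has _ _ hi, map_smul, psiStarBasis_of_has j, smul_zero]
      exact (I.has_erase hi j).2 ⟨hj, hij'.symm⟩
    · rw [psiBasis_of_not_has _ _ hi, map_zero]
  · rw [psiStarBasis_of_not_has _ _ hj, map_smul]
    by_cases hi : I.Has i
    · have hij1 : ¬ (I.erase (I.pos i)).Has j := fun h => hj ((I.has_erase hi j).1 h).1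
      have hji1 : (I.insert j hj).Has i := (I.has_insert j hj i).2 (Or.inl hi)
      rw [psiBasis_of_has _ _ hi, psiBasis_of_has _ _ hji1, map_smul,
        psiStarBasis_of_not_has _ _ hij1]
      have e : (I.erase (I.pos i)).insert j hij1 =
          (I.insert j hj).erase ((I.insert j hj).pos i) := by
        refine SeaSeq.ext_has fun k => ?_
        rw [SeaSeq.has_insert, SeaSeq.has_erase _ hji1, SeaSeq.has_erase _ hi,
          SeaSeq.has_insert]
        have : k = j → k ≠ i := by rintro rfl; exact hij'.symm
        tauto
      rw [e, smul_smul, smul_smul, ← add_smul]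
      have p1 := I.pos_erase hi j
      have p2 := I.pos_insert j hj i
      rw [neg_one_pow_mul_add_eq_zero, zero_smul]
      split_ifs at p1 p2 <;> omega
    · rw [psiBasis_of_not_has _ _ hi, map_zero, psiBasis_of_not_has i, smul_zero, add_zero]
      rw [I.has_insert j hj]
      tauto

/-! ### The field operators of the Dirac sea -/

section

variable {H : Type*} [NormedAddCommGroup H] [InnerProductSpace ℂ H] (e : HilbertBasis NZ ℂ H)

/-- By the anticommutation relations `A * A† + A† * A = ∑ |cᵢ|²` for `A = ∑ cᵢ ψ(eᵢ)`. -/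
theorem norm_sum_smul_psiBasis_le (s : Finset NZ) (c : NZ → ℂ) :
    ‖∑ i ∈ s, c i • psiBasis i‖ ≤ √(∑ i ∈ s, ‖c i‖ ^ 2) := by
  set A : SeaSpace →L[ℂ] SeaSpace := ∑ i ∈ s, c i • psiBasis i with hA
  have hA' : A.adjoint = ∑ i ∈ s, starRingEnd ℂ (c i) • psiStarBasis i := by
    simp_rw [hA, map_sum, map_smulₛₗ, adjoint_psiBasis]
  have key : A * A.adjoint + A.adjoint * A = ((∑ i ∈ s, ‖c i‖ ^ 2 : ℝ) : ℂ) • 1 := by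
    have h : ∀ i j, (c i • psiBasis i) * (starRingEnd ℂ (c j) • psiStarBasis j) +
        (starRingEnd ℂ (c j) • psiStarBasis j) * (c i • psiBasis i) =
        (if i = j then (‖c i‖ : ℂ) ^ 2 else 0) • (1 : SeaSpace →L[ℂ] SeaSpace) := by
      intro i j
      rw [smul_mul_smul_comm, smul_mul_smul_comm, mul_comm (starRingEnd ℂ (c j)), ← smul_add,
        psiBasis_psiStarBasis, smul_smul]
      split_ifs with hij
      · rw [← hij, Complex.mul_conj']; simp
      · simp
    rw [hA', hA, Finset.sum_mul_sum, Finset.sum_mul_sum, Finset.sum_comm (s := s) (t := s),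
      ← Finset.sum_add_distrib]
    simp_rw [← Finset.sum_add_distrib]
    rw [Finset.sum_congr rfl fun j _ => Finset.sum_congr rfl fun i _ => h i j]
    push_cast
    rw [Finset.sum_smul]
    refine Finset.sum_congr rfl fun j hj => ?_
    rw [← Finset.sum_smul, Finset.sum_ite_eq' s j, if_pos hj]
  refine ContinuousLinearMap.opNorm_le_bound _ (Real.sqrt_nonneg _) fun x => ?_
  have h1 : ‖A.adjoint x‖ ^ 2 + ‖A x‖ ^ 2 = (∑ i ∈ s, ‖c i‖ ^ 2) * ‖x‖ ^ 2 := by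
    have h := congrArg (fun T : SeaSpace →L[ℂ] SeaSpace => inner ℂ x (T x)) key
    simp only [add_apply, mul_apply_eq_comp, smul_apply, one_apply_eq_self, inner_add_right,
      inner_smul_right] at h
    have e1 : inner ℂ x (A (A.adjoint x)) = inner ℂ (A.adjoint x) (A.adjoint x) :=
      (A.adjoint_inner_left _ _).symm
    have e2 : inner ℂ x (A.adjoint (A x)) = inner ℂ (A x) (A x) := A.adjoint_inner_right _ _
    rw [e1, e2] at h
    refine Complex.ofReal_injective ?_
    simpa [inner_self_eq_norm_sq_to_K] using h
  refine le_of_sq_le_sq ?_ (by positivity)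
  rw [mul_pow, Real.sq_sqrt (by positivity)]
  nlinarith [sq_nonneg ‖A.adjoint x‖]

/-- The series for `ψ(f)` converges unconditionally in norm: by the norm bound for finite sums this
follows from Bessel's inequality. -/
theorem summable_psi (f : H) : Summable fun i : NZ => inner ℂ f (e i) • psiBasis i := by
  have hs : Summable fun i => ‖inner ℂ f (e i)‖ ^ 2 := by
    have := e.orthonormal.inner_products_summable (x := f)
    simpa only [norm_inner_symm] using this
  rw [summable_iff_vanishing_norm] at hs ⊢
  intro ε hε
  obtain ⟨s, h⟩ := hs (ε ^ 2) (by positivity)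
  refine ⟨s, fun t ht => (norm_sum_smul_psiBasis_le t _).trans_lt ?_⟩
  rw [Real.sqrt_lt' hε]
  exact (le_abs_self _).trans_lt (h t ht)

theorem hasSum_psi (f : H) : HasSum (fun i : NZ => inner ℂ f (e i) • psiBasis i) (psi e f) :=
  (summable_psi e f).hasSum

theorem hasSum_adjoint_psi (f : H) :
    HasSum (fun i : NZ => inner ℂ (e i) f • psiStarBasis i) (psi e f).adjoint := by
  have h : HasSum (fun i => (inner ℂ f (e i) • psiBasis i).adjoint) (psi e f).adjoint :=
    (hasSum_psi e f).map ContinuousLinearMap.adjoint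
      (LinearIsometryEquiv.continuous (ContinuousLinearMap.adjoint (𝕜 := ℂ)))
  simpa only [map_smulₛₗ, inner_conj_symm, adjoint_psiBasis] using h

theorem summable_psiStar (f : H) : Summable fun i : NZ => inner ℂ (e i) f • psiStarBasis i :=
  (hasSum_adjoint_psi e f).summable

theorem adjoint_psi (f : H) : (psi e f).adjoint = psiStar e f :=
  (hasSum_adjoint_psi e f).tsum_eq.symm

theorem hasSum_psiStar (f : H) :
    HasSum (fun i : NZ => inner ℂ (e i) f • psiStarBasis i) (psiStar e f) :=
  (summable_psiStar e f).hasSum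

theorem adjoint_psiStar (f : H) : (psiStar e f).adjoint = psi e f := by
  rw [← adjoint_psi, ContinuousLinearMap.adjoint_adjoint]

theorem psi_add (f g : H) : psi e (f + g) = psi e f + psi e g := by
  refine (hasSum_psi e (f + g)).unique ?_
  simpa only [inner_add_left, add_smul] using (hasSum_psi e f).add (hasSum_psi e g)

theorem psiStar_add (f g : H) : psiStar e (f + g) = psiStar e f + psiStar e g := by
  rw [← adjoint_psi, psi_add, map_add, adjoint_psi, adjoint_psi]

theorem psiStar_smul (c : ℂ) (f : H) : psiStar e (c • f) = c • psiStar e f := by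
  refine (hasSum_psiStar e (c • f)).unique ?_
  simpa only [inner_smul_right, smul_smul] using (hasSum_psiStar e f).const_smul c

theorem psi_smul (c : ℂ) (f : H) : psi e (c • f) = starRingEnd ℂ c • psi e f := by
  rw [← adjoint_psiStar, psiStar_smul, map_smulₛₗ, adjoint_psiStar]

theorem psi_basis (i : NZ) : psi e (e i) = psiBasis i := by
  have h : inner ℂ (e i) (e i) • psiBasis i = psiBasis i := by
    rw [inner_self_eq_norm_sq_to_K, e.orthonormal.norm_eq_one]
    simp
  refine (hasSum_psi e (e i)).unique ?_
  rw [← h]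
  refine hasSum_single i fun k hk => ?_
  rw [e.orthonormal.inner_eq_zero hk.symm, zero_smul]

theorem psiStar_basis (i : NZ) : psiStar e (e i) = psiStarBasis i := by
  rw [← adjoint_psi, psi_basis, adjoint_psiBasis]

theorem psi_psi (f g : H) : psi e f * psi e g + psi e g * psi e f = 0 := by
  have h1 : ∀ i, psiBasis i * psi e g + psi e g * psiBasis i = 0 := by
    intro i
    refine (((hasSum_psi e g).mul_left (psiBasis i)).add
      ((hasSum_psi e g).mul_right (psiBasis i))).unique ?_
    simp only [mul_smul_comm, smul_mul_assoc, ← smul_add, psiBasis_psiBasis, smul_zero]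
    exact hasSum_zero
  refine (((hasSum_psi e f).mul_right (psi e g)).add
    ((hasSum_psi e f).mul_left (psi e g))).unique ?_
  simp only [mul_smul_comm, smul_mul_assoc, ← smul_add, h1, smul_zero]
  exact hasSum_zero

theorem psi_mul_self (f : H) : psi e f * psi e f = 0 := by
  have h := psi_psi e f f
  rw [← two_smul ℂ] at h
  exact (smul_eq_zero.1 h).resolve_left two_ne_zero

theorem psiStar_mul_self (f : H) : psiStar e f * psiStar e f = 0 := by
  have := congrArg star (psi_mul_self e f)
  rw [star_mul, star_zero] at this
  simpa only [ContinuousLinearMap.star_eq_adjoint, adjoint_psi] using this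

theorem psi_psiStar (f g : H) :
    psi e f * psiStar e g + psiStar e g * psi e f = (inner ℂ f g : ℂ) • 1 := by
  have h1 : ∀ i, psiBasis i * psiStar e g + psiStar e g * psiBasis i =
      (inner ℂ (e i) g : ℂ) • 1 := by
    intro i
    refine (((hasSum_psiStar e g).mul_left (psiBasis i)).add
      ((hasSum_psiStar e g).mul_right (psiBasis i))).unique ?_
    simp only [mul_smul_comm, smul_mul_assoc, ← smul_add, psiBasis_psiStarBasis, smul_smul,
      mul_ite, mul_one, mul_zero]
    convert hasSum_single i fun k hk => ?_ using 1
    · rw [if_pos rfl]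
    · rw [if_neg hk.symm, zero_smul]
  refine (((hasSum_psi e f).mul_right (psiStar e g)).add
    ((hasSum_psi e f).mul_left (psiStar e g))).unique ?_
  simp only [mul_smul_comm, smul_mul_assoc, ← smul_add, h1, smul_smul]
  exact (e.hasSum_inner_mul_inner f g).smul_const _

end

/-- The set of particles and antiparticles of `I`: its positive entries and the negative integers
that are missing from it. -/
def SeaSeq.excitations (I : SeaSeq) : Set ℤ := {j | 0 < j ∧ I.Has j ∨ j < 0 ∧ ¬ I.Has j}

theorem SeaSeq.finite_excitations (I : SeaSeq) : I.excitations.Finite := by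
  obtain ⟨K, hK⟩ := I.filled
  have hfill : ∀ n : ℕ, I.seq (K + n) = I.seq K - n := by
    intro n
    induction n with
    | zero => simp
    | succ n ih => rw [← add_assoc, hK _ (by omega), ih]; push_cast; ring
  refine (Set.finite_Icc (min (I.seq K) 0) (max (I.seq 0) 0)).subset fun j hj => ?_
  rcases hj with ⟨h0, k, rfl⟩ | ⟨h0, hj⟩
  · have := I.seq_strictAnti.antitone (Nat.zero_le k)
    exact ⟨by omega, by omega⟩
  · refine ⟨?_, by omega⟩
    by_contra! h
    refine hj ⟨K + (I.seq K - j).toNat, ?_⟩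
    rw [hfill]
    omega

/-- Every basis vector arises from the Dirac sea by creating particles and antiparticles. -/
theorem sea_cyclic (S : Submodule ℂ SeaSpace) (hS : IsClosed (S : Set SeaSpace))
    (h0 : seaVacuum ∈ S) (hp : ∀ j : NZ, 0 < j.1 → ∀ Φ ∈ S, psiStarBasis j Φ ∈ S)
    (hn : ∀ j : NZ, j.1 < 0 → ∀ Φ ∈ S, psiBasis j Φ ∈ S) : S = ⊤ := by
  have key : ∀ (n : ℕ) (I : SeaSeq), I.excitations.ncard = n → seaVec I ∈ S := by
    intro n
    induction n with
    | zero =>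
      intro I hI
      rw [Set.ncard_eq_zero I.finite_excitations] at hI
      have : I = SeaSeq.sea := by
        refine SeaSeq.ext_has fun j => ?_
        rw [SeaSeq.has_sea]
        have hj : j ∉ I.excitations := by rw [hI]; simp
        simp only [SeaSeq.excitations, Set.mem_ofPred_eq] at hj
        have : I.Has j → j ≠ 0 := by rintro ⟨k, rfl⟩; exact I.ne_zero k
        by_cases h : I.Has j
        · have := this h
          simp only [h, not_true, and_true, and_false, or_false] at hj
          simp only [h, true_iff]
          omega
        · simp only [h, not_false_iff, and_true, and_false, false_or] at hj
          simp [h, hj]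
      rw [this]
      exact h0
    | succ n ih =>
      intro I hI
      obtain ⟨j, hj⟩ := Set.nonempty_of_ncard_ne_zero (s := I.excitations) (by omega)
      have hcard := Set.ncard_sdiff_singleton_of_mem hj
      have unsign : ∀ (p : ℕ) (v : SeaSpace), (-1 : ℂ) ^ p • v ∈ S → v ∈ S := by
        intro p v hv
        have := S.smul_mem ((-1 : ℂ) ^ p) hv
        rwa [smul_smul, ← mul_pow, neg_one_mul, neg_neg, one_pow, one_smul] at this
      rcases hj with ⟨hj0, hj⟩ | ⟨hj0, hj⟩
      · have hJ : seaVec (I.erase (I.pos j)) ∈ S := by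
          refine ih _ ?_
          rw [← Nat.add_sub_cancel n 1, ← hI, ← hcard]
          congr 1
          ext k
          simp only [SeaSeq.excitations, Set.mem_ofPred_eq, I.has_erase hj, Set.mem_sdiff,
            Set.mem_singleton_iff]
          have : k = j → ¬ k < 0 := by omega
          tauto
        have := hp ⟨j, by omega⟩ hj0 _ hJ
        rw [psiStarBasis_of_not_has _ _ (I.erase_not_has j hj),
          I.insert_erase ⟨j, by omega⟩ hj] at this
        exact unsign _ _ this
      · have hJ : seaVec (I.insert ⟨j, by omega⟩ hj) ∈ S := by
          refine ih _ ?_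
          rw [← Nat.add_sub_cancel n 1, ← hI, ← hcard]
          congr 1
          ext k
          simp only [SeaSeq.excitations, Set.mem_ofPred_eq, I.has_insert ⟨j, _⟩ hj, Set.mem_sdiff,
            Set.mem_singleton_iff]
          have : k = j → ¬ 0 < k := by omega
          tauto
        have := hn ⟨j, by omega⟩ hj0 _ hJ
        rw [psiBasis_of_has _ _ (I.insert_has ⟨j, _⟩ hj), I.insert_pos ⟨j, _⟩ hj,
          I.erase_insert ⟨j, _⟩ hj] at this
        exact unsign _ _ this
  have : IsClosed (S : Set SeaSpace) := hS
  have hq : S.mkQL = 0 := sea_ext fun I => by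
    simpa using (key _ I rfl)
  rw [eq_top_iff]
  intro Φ _
  have := DFunLike.congr_fun hq Φ
  simpa using this

/-! ### The tensor square of the Fock space -/

section

variable {K : Type*} [NormedAddCommGroup K] [InnerProductSpace ℂ K]

theorem fockAnnihilate_coe (h : K) (x : ExteriorAlgebra ℂ K) :
    fockAnnihilate h (x : Fock K) = (contract h x : ExteriorAlgebra ℂ K) :=
  ContinuousLinearMap.completion_apply_coe _ _

theorem fockParity_coe (x : ExteriorAlgebra ℂ K) :
    fockParity K (x : Fock K) = (extParity x : ExteriorAlgebra ℂ K) :=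
  ContinuousLinearMap.completion_apply_coe _ _

/-- Bounded operators on the Fock space agree if they agree on the exterior algebra. -/
theorem fock_ext {X : Type*} [NormedAddCommGroup X] [NormedSpace ℂ X] {A B : Fock K →L[ℂ] X}
    (h : ∀ x : ExteriorAlgebra ℂ K, A (x : Fock K) = B (x : Fock K)) : A = B := by
  ext x
  induction x using UniformSpace.Completion.induction_on with
  | hp => exact isClosed_eq A.continuous B.continuous
  | ih x => exact h x

/-- The creation operators act on the exterior algebra as exterior multiplication. -/
theorem adjoint_fockAnnihilate_coe (h : K) (x : ExteriorAlgebra ℂ K) :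
    (fockAnnihilate h).adjoint (x : Fock K) =
      (ExteriorAlgebra.ι ℂ h * x : ExteriorAlgebra ℂ K) := by
  refine ext_inner_right ℂ fun y => ?_
  rw [ContinuousLinearMap.adjoint_inner_left]
  induction y using UniformSpace.Completion.induction_on with
  | hp => exact isClosed_eq (by fun_prop) (by fun_prop)
  | ih y =>
    rw [fockAnnihilate_coe, UniformSpace.Completion.inner_coe, UniformSpace.Completion.inner_coe,
      inner_ext, inner_ext, extForm_ι_mul]

theorem extParity_extParity (x : ExteriorAlgebra ℂ K) : extParity (extParity x) = x := by
  induction x using ext_induction with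
  | h0 r => rw [extParity_algebraMap, extParity_algebraMap]
  | h1 x y hx hy => rw [map_add, map_add, hx, hy]
  | h2 x f hx => rw [extParity_ι_mul, map_neg, extParity_ι_mul, hx, neg_neg]

theorem fockParity_mul_self : fockParity K * fockParity K = 1 :=
  fock_ext fun x => by
    rw [mul_apply_eq_comp, fockParity_coe, fockParity_coe, extParity_extParity, one_apply_eq_self]

theorem adjoint_fockParity : (fockParity K).adjoint = fockParity K := by
  refine fock_ext fun x => ext_inner_right ℂ fun y => ?_
  rw [ContinuousLinearMap.adjoint_inner_left]
  induction y using UniformSpace.Completion.induction_on with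
  | hp => exact isClosed_eq (by fun_prop) (by fun_prop)
  | ih y =>
    rw [fockParity_coe, fockParity_coe, UniformSpace.Completion.inner_coe,
      UniformSpace.Completion.inner_coe, ← inner_extParity x, extParity_extParity]

theorem fockAnnihilate_mul_parity (h : K) :
    fockAnnihilate h * fockParity K = -(fockParity K * fockAnnihilate h) :=
  fock_ext fun x => by
    rw [mul_apply_eq_comp, neg_apply, mul_apply_eq_comp, fockParity_coe, fockAnnihilate_coe,
      fockAnnihilate_coe, fockParity_coe, contract_extParity, UniformSpace.Completion.coe_neg]

theorem fockAnnihilate_mul_self (h : K) : fockAnnihilate h * fockAnnihilate h = 0 :=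
  fock_ext fun x => by
    rw [mul_apply_eq_comp, fockAnnihilate_coe, fockAnnihilate_coe, contract_contract,
      UniformSpace.Completion.coe_zero, zero_apply]

theorem fockAnnihilate_anticomm (f g : K) :
    fockAnnihilate f * (fockAnnihilate g).adjoint + (fockAnnihilate g).adjoint * fockAnnihilate f =
      (inner ℂ f g : ℂ) • 1 :=
  fock_ext fun x => by
    rw [add_apply, mul_apply_eq_comp, mul_apply_eq_comp, adjoint_fockAnnihilate_coe,
      fockAnnihilate_coe, fockAnnihilate_coe, adjoint_fockAnnihilate_coe, contract_ι_mul,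
      smul_apply, one_apply_eq_self, ← UniformSpace.Completion.coe_add, sub_add_cancel,
      UniformSpace.Completion.coe_smul]

theorem adjoint_fockAnnihilate_add (f g : K) :
    (fockAnnihilate (f + g)).adjoint = (fockAnnihilate f).adjoint + (fockAnnihilate g).adjoint :=
  fock_ext fun x => by
    simp only [add_apply, adjoint_fockAnnihilate_coe, map_add, add_mul,
      UniformSpace.Completion.coe_add]

theorem adjoint_fockAnnihilate_smul (c : ℂ) (f : K) :
    (fockAnnihilate (c • f)).adjoint = c • (fockAnnihilate f).adjoint :=
  fock_ext fun x => by
    simp only [smul_apply, adjoint_fockAnnihilate_coe, map_smul, smul_mul_assoc,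
      UniformSpace.Completion.coe_smul]

theorem fockAnnihilate_vacuum (h : K) : fockAnnihilate h (fockVacuum K) = 0 := by
  rw [fockVacuum, fockAnnihilate_coe, contract_one, UniformSpace.Completion.coe_zero]

theorem fockParity_vacuum : fockParity K (fockVacuum K) = fockVacuum K := by
  rw [fockVacuum, fockParity_coe, ← map_one (algebraMap ℂ (ExteriorAlgebra ℂ K)),
    extParity_algebraMap]

theorem norm_fockVacuum : ‖fockVacuum K‖ = 1 := by
  rw [fockVacuum, UniformSpace.Completion.norm_coe, ← ExteriorAlgebra.ιMulti_zero_apply (R := ℂ)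
    (v := (Fin.elim0 : Fin 0 → K)), @norm_eq_sqrt_re_inner ℂ, inner_ιMulti]
  simp

/-- A shortcut: without it the instance is not found when `K` is a subspace of an `L²` space. -/
instance instInnerProductSpaceFockPair : InnerProductSpace ℂ (FockPair K) :=
  UniformSpace.Completion.innerProductSpace

/-- The pure tensor `x ⊗ y` in the Hilbert space tensor product. -/
def pairTensor (x y : Fock K) : FockPair K :=
  ((x ⊗ₜ[ℂ] y : TensorProduct ℂ (Fock K) (Fock K)) : FockPair K)

theorem pairTensor_add_left (x x' y : Fock K) :
    pairTensor (x + x') y = pairTensor x y + pairTensor x' y := by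
  rw [pairTensor, TensorProduct.add_tmul, UniformSpace.Completion.coe_add]; rfl

theorem pairTensor_add_right (x y y' : Fock K) :
    pairTensor x (y + y') = pairTensor x y + pairTensor x y' := by
  rw [pairTensor, TensorProduct.tmul_add, UniformSpace.Completion.coe_add]; rfl

theorem pairTensor_smul_left (c : ℂ) (x y : Fock K) :
    pairTensor (c • x) y = c • pairTensor x y := by
  rw [pairTensor, ← TensorProduct.smul_tmul', UniformSpace.Completion.coe_smul]; rfl

theorem pairTensor_smul_right (c : ℂ) (x y : Fock K) :
    pairTensor x (c • y) = c • pairTensor x y := by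
  rw [pairTensor, TensorProduct.tmul_smul, UniformSpace.Completion.coe_smul]; rfl

theorem inner_pairTensor (x y x' y' : Fock K) :
    inner ℂ (pairTensor x y) (pairTensor x' y') = inner ℂ x x' * inner ℂ y y' := by
  rw [pairTensor, pairTensor, UniformSpace.Completion.inner_coe, TensorProduct.inner_tmul]

theorem continuous_pairTensor :
    Continuous fun p : Fock K × Fock K => pairTensor p.1 p.2 := by
  refine (UniformSpace.Completion.continuous_coe _).comp ?_
  let B : Fock K →L[ℂ] Fock K →L[ℂ] TensorProduct ℂ (Fock K) (Fock K) :=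
    (TensorProduct.mk ℂ (Fock K) (Fock K)).mkContinuous₂ 1 fun x y => by simp
  exact B.continuous₂

theorem tensorOp_pairTensor (A B : Fock K →L[ℂ] Fock K) (x y : Fock K) :
    tensorOp A B (pairTensor x y) = pairTensor (A x) (B y) := by
  rw [tensorOp, pairTensor, ContinuousLinearMap.completion_apply_coe]
  simp [pairTensor]

/-- A closed subspace of the Hilbert space tensor product that contains the tensors `x ⊗ y` with
`x` and `y` in the exterior algebra is everything. -/
theorem pair_eq_top (S : Submodule ℂ (FockPair K)) (hS : IsClosed (S : Set (FockPair K)))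
    (h : ∀ x y : ExteriorAlgebra ℂ K, pairTensor (x : Fock K) (y : Fock K) ∈ S) : S = ⊤ := by
  have h1 : ∀ x y : Fock K, pairTensor x y ∈ S := fun x y => by
    induction x, y using UniformSpace.Completion.induction_on₂ with
    | hp => exact hS.preimage continuous_pairTensor
    | ih x y => exact h x y
  refine (Submodule.eq_top_iff').2 fun Φ => ?_
  induction Φ using UniformSpace.Completion.induction_on with
  | hp => exact hS
  | ih t =>
    induction t using TensorProduct.induction_on with
    | zero =>
      rw [UniformSpace.Completion.coe_zero]
      exact S.zero_mem
    | tmul x y => exact h1 x y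
    | add s t hs ht => rw [UniformSpace.Completion.coe_add]; exact S.add_mem hs ht

/-- Bounded operators on the tensor product agree if they agree on pure tensors. -/
theorem pair_ext {X : Type*} [NormedAddCommGroup X] [NormedSpace ℂ X] {A B : FockPair K →L[ℂ] X}
    (h : ∀ x y, A (pairTensor x y) = B (pairTensor x y)) : A = B := by
  have := pair_eq_top (A - B).ker (A - B).isClosed_ker fun x y => by
    simp [h]
  ext Φ
  have : Φ ∈ (A - B).ker := this ▸ trivial
  simpa [sub_eq_zero] using this

theorem tensorOp_mul (A B A' B' : Fock K →L[ℂ] Fock K) :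
    tensorOp A B * tensorOp A' B' = tensorOp (A * A') (B * B') :=
  pair_ext fun x y => by simp only [mul_apply_eq_comp, tensorOp_pairTensor]

theorem tensorOp_add_left (A A' B : Fock K →L[ℂ] Fock K) :
    tensorOp (A + A') B = tensorOp A B + tensorOp A' B :=
  pair_ext fun x y => by simp only [add_apply, tensorOp_pairTensor, pairTensor_add_left]

theorem tensorOp_add_right (A B B' : Fock K →L[ℂ] Fock K) :
    tensorOp A (B + B') = tensorOp A B + tensorOp A B' :=
  pair_ext fun x y => by simp only [add_apply, tensorOp_pairTensor, pairTensor_add_right]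

theorem tensorOp_smul_left (c : ℂ) (A B : Fock K →L[ℂ] Fock K) :
    tensorOp (c • A) B = c • tensorOp A B :=
  pair_ext fun x y => by simp only [smul_apply, tensorOp_pairTensor, pairTensor_smul_left]

theorem tensorOp_smul_right (c : ℂ) (A B : Fock K →L[ℂ] Fock K) :
    tensorOp A (c • B) = c • tensorOp A B :=
  pair_ext fun x y => by simp only [smul_apply, tensorOp_pairTensor, pairTensor_smul_right]

theorem tensorOp_zero_left (B : Fock K →L[ℂ] Fock K) : tensorOp 0 B = 0 := by
  simpa using tensorOp_smul_left 0 0 B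

theorem tensorOp_zero_right (A : Fock K →L[ℂ] Fock K) : tensorOp A 0 = 0 := by
  simpa using tensorOp_smul_right 0 A 0

theorem tensorOp_one : tensorOp (1 : Fock K →L[ℂ] Fock K) 1 = 1 :=
  pair_ext fun x y => by simp only [one_apply_eq_self, tensorOp_pairTensor]

theorem adjoint_tensorOp (A B : Fock K →L[ℂ] Fock K) :
    (tensorOp A B).adjoint = tensorOp A.adjoint B.adjoint := by
  refine pair_ext fun x y => ext_inner_right ℂ fun Φ => ?_
  refine DFunLike.congr_fun (f := innerSL ℂ ((tensorOp A B).adjoint (pairTensor x y)))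
    (g := innerSL ℂ (tensorOp A.adjoint B.adjoint (pairTensor x y))) (pair_ext fun x' y' => ?_) Φ
  rw [innerSL_apply_apply, innerSL_apply_apply, ContinuousLinearMap.adjoint_inner_left,
    tensorOp_pairTensor, tensorOp_pairTensor, inner_pairTensor, inner_pairTensor,
    ContinuousLinearMap.adjoint_inner_left, ContinuousLinearMap.adjoint_inner_left]

theorem adjoint_fockA (h : K) : (fockA h).adjoint = tensorOp (fockAnnihilate h).adjoint 1 := by
  rw [fockA, adjoint_tensorOp]
  congr 1
  exact ContinuousLinearMap.adjoint_id

theorem adjoint_fockB (h : K) :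
    (fockB h).adjoint = tensorOp (fockParity K) (fockAnnihilate h).adjoint := by
  rw [fockB, adjoint_tensorOp, adjoint_fockParity]

theorem fockParity_mul_adjoint (h : K) :
    fockParity K * (fockAnnihilate h).adjoint = -((fockAnnihilate h).adjoint * fockParity K) := by
  have := congrArg star (fockAnnihilate_mul_parity h)
  rwa [star_mul, star_neg, star_mul, ContinuousLinearMap.star_eq_adjoint,
    ContinuousLinearMap.star_eq_adjoint, adjoint_fockParity] at this

theorem adjoint_fockAnnihilate_mul_self (h : K) :
    (fockAnnihilate h).adjoint * (fockAnnihilate h).adjoint = 0 := by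
  have := congrArg star (fockAnnihilate_mul_self h)
  rwa [star_mul, star_zero, ContinuousLinearMap.star_eq_adjoint] at this

theorem adjoint_fockA_mul_self (f : K) : (fockA f).adjoint * (fockA f).adjoint = 0 := by
  rw [adjoint_fockA, tensorOp_mul, adjoint_fockAnnihilate_mul_self, tensorOp_zero_left]

theorem adjoint_fockB_mul_self (f : K) : (fockB f).adjoint * (fockB f).adjoint = 0 := by
  rw [adjoint_fockB, tensorOp_mul, adjoint_fockAnnihilate_mul_self, tensorOp_zero_right]

theorem adjoint_fockA_adjoint_fockB (f g : K) :
    (fockA f).adjoint * (fockB g).adjoint + (fockB g).adjoint * (fockA f).adjoint = 0 := by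
  rw [adjoint_fockA, adjoint_fockB, tensorOp_mul, tensorOp_mul, one_mul, mul_one,
    ← tensorOp_add_left, fockParity_mul_adjoint, add_neg_cancel, tensorOp_zero_left]

theorem fockA_adjoint_fockA (f g : K) :
    fockA f * (fockA g).adjoint + (fockA g).adjoint * fockA f = (inner ℂ f g : ℂ) • 1 := by
  rw [adjoint_fockA, fockA, tensorOp_mul, tensorOp_mul]
  change tensorOp _ (1 * 1) + tensorOp _ (1 * 1) = _
  rw [← tensorOp_add_left, fockAnnihilate_anticomm, one_mul, tensorOp_smul_left, tensorOp_one]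

theorem fockB_adjoint_fockB (f g : K) :
    fockB f * (fockB g).adjoint + (fockB g).adjoint * fockB f = (inner ℂ f g : ℂ) • 1 := by
  rw [adjoint_fockB, fockB, tensorOp_mul, tensorOp_mul, fockParity_mul_self,
    ← tensorOp_add_right, fockAnnihilate_anticomm, tensorOp_smul_right, tensorOp_one]

theorem fockA_adjoint_fockB (f g : K) :
    fockA f * (fockB g).adjoint + (fockB g).adjoint * fockA f = 0 := by
  rw [adjoint_fockB, fockA, tensorOp_mul, tensorOp_mul]
  change tensorOp _ (1 * _) + tensorOp _ (_ * 1) = _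
  rw [one_mul, mul_one, ← tensorOp_add_left, fockAnnihilate_mul_parity, neg_add_cancel,
    tensorOp_zero_left]

theorem pairTensor_zero_left (y : Fock K) : pairTensor 0 y = 0 := by
  simpa using pairTensor_smul_left 0 0 y

theorem pairTensor_zero_right (x : Fock K) : pairTensor x 0 = 0 := by
  simpa using pairTensor_smul_right 0 x 0

variable (K) in
theorem fockPairVacuum_eq : fockPairVacuum K = pairTensor (fockVacuum K) (fockVacuum K) := rfl

theorem fockA_vacuum (f : K) : fockA f (fockPairVacuum K) = 0 := by
  rw [fockPairVacuum_eq, fockA, tensorOp_pairTensor, fockAnnihilate_vacuum, pairTensor_zero_left]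

theorem fockB_vacuum (f : K) : fockB f (fockPairVacuum K) = 0 := by
  rw [fockPairVacuum_eq, fockB, tensorOp_pairTensor, fockAnnihilate_vacuum, pairTensor_zero_right]

theorem norm_fockPairVacuum : ‖fockPairVacuum K‖ = 1 := by
  rw [fockPairVacuum, UniformSpace.Completion.norm_coe, TensorProduct.norm_tmul, norm_fockVacuum,
    one_mul]

theorem fockPair_cyclic (S : Submodule ℂ (FockPair K)) (hS : IsClosed (S : Set (FockPair K)))
    (h0 : fockPairVacuum K ∈ S) (hA : ∀ f, ∀ x ∈ S, (fockA f).adjoint x ∈ S)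
    (hB : ∀ f, ∀ x ∈ S, (fockB f).adjoint x ∈ S) : S = ⊤ := by
  refine pair_eq_top S hS fun x y => ?_
  -- antiparticles first: the sign operator in `b*` acts on the vacuum as the identity
  have h1 : pairTensor (fockVacuum K) (y : Fock K) ∈ S := by
    induction y using ext_induction with
    | h0 r =>
      rw [Algebra.algebraMap_eq_smul_one, UniformSpace.Completion.coe_smul,
        pairTensor_smul_right]
      exact S.smul_mem _ h0
    | h1 x y hx hy =>
      rw [UniformSpace.Completion.coe_add, pairTensor_add_right]
      exact S.add_mem hx hy
    | h2 x f hx =>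
      have : (fockB f).adjoint (pairTensor (fockVacuum K) (x : Fock K)) ∈ S := hB f _ hx
      rwa [adjoint_fockB, tensorOp_pairTensor, fockParity_vacuum,
        adjoint_fockAnnihilate_coe] at this
  induction x using ext_induction with
  | h0 r =>
    rw [Algebra.algebraMap_eq_smul_one, UniformSpace.Completion.coe_smul,
      pairTensor_smul_left]
    exact S.smul_mem _ h1
  | h1 x x' hx hx' =>
    rw [UniformSpace.Completion.coe_add, pairTensor_add_left]
    exact S.add_mem hx hx'
  | h2 x f hx =>
    have : (fockA f).adjoint (pairTensor (x : Fock K) (y : Fock K)) ∈ S := hA f _ hx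
    rwa [adjoint_fockA, tensorOp_pairTensor, one_apply_eq_self,
      adjoint_fockAnnihilate_coe] at this

end

namespace FockRep

variable {K X : Type*} [NormedAddCommGroup K] [InnerProductSpace ℂ K]
  [NormedAddCommGroup X] [InnerProductSpace ℂ X] [CompleteSpace X]

/-- Two mutually anticommuring families of creation operators over `K`, for particles and for
antiparticles, form one family over the Hilbert sum `K ⊕ K`. -/
def ofPair (ca cb : K →ₗ[ℂ] X →L[ℂ] X) (vac : X)
    (haa : ∀ f, ca f * ca f = 0) (hbb : ∀ f, cb f * cb f = 0)
    (hab : ∀ f g, ca f * cb g + cb g * ca f = 0)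
    (ha : ∀ f g, (ca f).adjoint * ca g + ca g * (ca f).adjoint = (inner ℂ f g : ℂ) • 1)
    (hb : ∀ f g, (cb f).adjoint * cb g + cb g * (cb f).adjoint = (inner ℂ f g : ℂ) • 1)
    (hm : ∀ f g, (ca f).adjoint * cb g + cb g * (ca f).adjoint = 0)
    (va : ∀ f, (ca f).adjoint vac = 0) (vb : ∀ f, (cb f).adjoint vac = 0) (hv : ‖vac‖ = 1)
    (hc : ∀ S : Submodule ℂ X, IsClosed (S : Set X) → vac ∈ S → (∀ f, ∀ x ∈ S, ca f x ∈ S) →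
      (∀ f, ∀ x ∈ S, cb f x ∈ S) → S = ⊤) :
    FockRep (WithLp 2 (K × K)) X where
  cre :=
    { toFun := fun p => ca p.fst + cb p.snd
      map_add' := fun p q => by
        rw [WithLp.add_fst, WithLp.add_snd, map_add, map_add]; abel
      map_smul' := fun c p => by
        rw [WithLp.smul_fst, WithLp.smul_snd, map_smul, map_smul, RingHom.id_apply, smul_add] }
  vac := vac
  cre_cre p x := by
    show ((ca p.fst + cb p.snd) * (ca p.fst + cb p.snd)) x = 0
    have : (ca p.fst + cb p.snd) * (ca p.fst + cb p.snd) = 0 := by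
      rw [add_mul, mul_add, mul_add, haa, hbb, zero_add, add_zero, hab]
    rw [this, zero_apply]
  anticomm p q x := by
    have hm' : ∀ f g, (cb f).adjoint * ca g + ca g * (cb f).adjoint = 0 := fun f g => by
      have := congrArg star (hm g f)
      rw [star_add, star_mul, star_mul, star_zero, ← ContinuousLinearMap.star_eq_adjoint,
        star_star, ContinuousLinearMap.star_eq_adjoint, add_comm] at this
      rwa [add_comm] at this
    show ((ca p.fst + cb p.snd).adjoint * (ca q.fst + cb q.snd) +
      (ca q.fst + cb q.snd) * (ca p.fst + cb p.snd).adjoint) x = _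
    have : (ca p.fst + cb p.snd).adjoint * (ca q.fst + cb q.snd) +
        (ca q.fst + cb q.snd) * (ca p.fst + cb p.snd).adjoint =
        ((ca p.fst).adjoint * ca q.fst + ca q.fst * (ca p.fst).adjoint) +
        ((cb p.snd).adjoint * cb q.snd + cb q.snd * (cb p.snd).adjoint) +
        ((ca p.fst).adjoint * cb q.snd + cb q.snd * (ca p.fst).adjoint) +
        ((cb p.snd).adjoint * ca q.fst + ca q.fst * (cb p.snd).adjoint) := by
      rw [map_add]; noncomm_ring
    rw [this, ha, hb, hm, hm', add_zero, add_zero, ← add_smul, WithLp.prod_inner_apply, smul_apply,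
      one_apply_eq_self]
    rfl
  ann_vac p := by
    show (ca p.fst + cb p.snd).adjoint vac = 0
    rw [map_add, add_apply, va, vb, add_zero]
  norm_vac := hv
  cyclic S hS h0 hcre := by
    refine hc S hS h0 (fun f x hx => ?_) fun f x hx => ?_
    · have : (ca f + cb 0) x ∈ S := hcre (WithLp.toLp 2 (f, 0)) x hx
      rwa [map_zero, add_zero] at this
    · have : (ca 0 + cb f) x ∈ S := hcre (WithLp.toLp 2 (0, f)) x hx
      rwa [map_zero, zero_add] at this

section

variable (ca cb : K →ₗ[ℂ] X →L[ℂ] X) (vac : X)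
    (haa : ∀ f, ca f * ca f = 0) (hbb : ∀ f, cb f * cb f = 0)
    (hab : ∀ f g, ca f * cb g + cb g * ca f = 0)
    (ha : ∀ f g, (ca f).adjoint * ca g + ca g * (ca f).adjoint = (inner ℂ f g : ℂ) • 1)
    (hb : ∀ f g, (cb f).adjoint * cb g + cb g * (cb f).adjoint = (inner ℂ f g : ℂ) • 1)
    (hm : ∀ f g, (ca f).adjoint * cb g + cb g * (ca f).adjoint = 0)
    (va : ∀ f, (ca f).adjoint vac = 0) (vb : ∀ f, (cb f).adjoint vac = 0) (hv : ‖vac‖ = 1)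
    (hc : ∀ S : Submodule ℂ X, IsClosed (S : Set X) → vac ∈ S → (∀ f, ∀ x ∈ S, ca f x ∈ S) →
      (∀ f, ∀ x ∈ S, cb f x ∈ S) → S = ⊤)

theorem ofPair_vac : (ofPair ca cb vac haa hbb hab ha hb hm va vb hv hc).vac = vac := rfl

theorem ofPair_cre_left (f : K) :
    (ofPair ca cb vac haa hbb hab ha hb hm va vb hv hc).cre (WithLp.toLp 2 (f, 0)) = ca f := by
  show ca f + cb 0 = ca f
  rw [map_zero, add_zero]

theorem ofPair_cre_right (f : K) :
    (ofPair ca cb vac haa hbb hab ha hb hm va vb hv hc).cre (WithLp.toLp 2 (0, f)) = cb f := by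
  show ca 0 + cb f = cb f
  rw [map_zero, zero_add]

end

/-- The representation on the tensor square of the Fock space. -/
def fockPair (K : Type*) [NormedAddCommGroup K] [InnerProductSpace ℂ K] :
    FockRep (WithLp 2 (K × K)) (FockPair K) :=
  ofPair
    { toFun := fun h => (fockA h).adjoint
      map_add' := fun f g => by
        simp only [adjoint_fockA, adjoint_fockAnnihilate_add, tensorOp_add_left]
      map_smul' := fun c f => by
        simp only [adjoint_fockA, adjoint_fockAnnihilate_smul, tensorOp_smul_left,
          RingHom.id_apply] }
    { toFun := fun h => (fockB h).adjoint
      map_add' := fun f g => by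
        simp only [adjoint_fockB, adjoint_fockAnnihilate_add, tensorOp_add_right]
      map_smul' := fun c f => by
        simp only [adjoint_fockB, adjoint_fockAnnihilate_smul, tensorOp_smul_right,
          RingHom.id_apply] }
    (fockPairVacuum K) adjoint_fockA_mul_self adjoint_fockB_mul_self adjoint_fockA_adjoint_fockB
    (fun f g => by
      simp only [LinearMap.coe_mk, AddHom.coe_mk, ContinuousLinearMap.adjoint_adjoint,
        fockA_adjoint_fockA])
    (fun f g => by
      simp only [LinearMap.coe_mk, AddHom.coe_mk, ContinuousLinearMap.adjoint_adjoint,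
        fockB_adjoint_fockB])
    (fun f g => by
      simp only [LinearMap.coe_mk, AddHom.coe_mk, ContinuousLinearMap.adjoint_adjoint,
        fockA_adjoint_fockB])
    (fun f => by
      simp only [LinearMap.coe_mk, AddHom.coe_mk, ContinuousLinearMap.adjoint_adjoint,
        fockA_vacuum])
    (fun f => by
      simp only [LinearMap.coe_mk, AddHom.coe_mk, ContinuousLinearMap.adjoint_adjoint,
        fockB_vacuum])
    norm_fockPairVacuum fockPair_cyclic

variable (K)

theorem fockPair_vac : (fockPair K).vac = fockPairVacuum K := by
  rw [fockPair, ofPair_vac]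

variable {K}

theorem adjoint_fockPair_cre_left (f : K) :
    ((fockPair K).cre (WithLp.toLp 2 (f, 0))).adjoint = fockA f := by
  rw [fockPair, ofPair_cre_left, LinearMap.coe_mk, AddHom.coe_mk,
    ContinuousLinearMap.adjoint_adjoint]

theorem adjoint_fockPair_cre_right (f : K) :
    ((fockPair K).cre (WithLp.toLp 2 (0, f))).adjoint = fockB f := by
  rw [fockPair, ofPair_cre_right, LinearMap.coe_mk, AddHom.coe_mk,
    ContinuousLinearMap.adjoint_adjoint]

/-- Every representation over `K ⊕ K` is unitarily equivalent to the one on the tensor square of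
the Fock space over `K`. -/
theorem exists_unitary_fockPair (R : FockRep (WithLp 2 (K × K)) X) :
    ∃ U : X ≃ₗᵢ[ℂ] FockPair K, U R.vac = fockPairVacuum K ∧
      (∀ h y, U ((R.cre (WithLp.toLp 2 (h, 0))).adjoint (U.symm y)) = fockA h y) ∧
      (∀ h y, U ((R.cre (WithLp.toLp 2 (0, h))).adjoint (U.symm y)) = fockB h y) ∧
      ∀ h k y, U (((R.cre (WithLp.toLp 2 (h, 0))).adjoint + R.cre (WithLp.toLp 2 (0, k)))
        (U.symm y)) = (fockA h + (fockB k).adjoint) y := by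
  obtain ⟨U, hU0, hU⟩ := R.exists_unitary (fockPair K)
  have hA : ∀ h y, U ((R.cre (WithLp.toLp 2 (h, 0))).adjoint (U.symm y)) = fockA h y :=
    fun h y => by rw [hU, adjoint_fockPair_cre_left, U.apply_symm_apply]
  have hB : ∀ h y, U ((R.cre (WithLp.toLp 2 (0, h))).adjoint (U.symm y)) = fockB h y :=
    fun h y => by rw [hU, adjoint_fockPair_cre_right, U.apply_symm_apply]
  refine ⟨U, by rw [hU0, fockPair_vac], hA, hB, fun h k y => ?_⟩
  rw [add_apply, map_add, hA, add_apply]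
  congr 1
  -- a unitary intertwiner also intertwines the adjoints
  refine ext_inner_right ℂ fun z => ?_
  rw [ContinuousLinearMap.adjoint_inner_left, ← hB, ← U.symm.inner_map_map, U.symm_apply_apply,
    ← U.symm.inner_map_map y, U.symm_apply_apply, ContinuousLinearMap.adjoint_inner_right]

end FockRep

/-! ### Fourier multipliers -/

theorem fourier_fourierMultiplier (T : Position → Spinor →L[ℂ] Spinor) (hT : MemLp T ∞ volume)
    (f : OneParticle) :
    Lp.fourierTransformₗᵢ Position Spinor (fourierMultiplier T hT f) =ᵐ[volume]
      fun p => T p (Lp.fourierTransformₗᵢ Position Spinor f p) := by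
  have h : Lp.fourierTransformₗᵢ Position Spinor (fourierMultiplier T hT f) =
      (ContinuousLinearMap.id ℂ (Spinor →L[ℂ] Spinor)).holder 2 (hT.toLp T)
        (Lp.fourierTransformₗᵢ Position Spinor f) :=
    (Lp.fourierTransformₗᵢ Position Spinor).apply_symm_apply _
  rw [h]
  filter_upwards [(ContinuousLinearMap.id ℂ (Spinor →L[ℂ] Spinor)).coeFn_holder (r := 2)
    (hT.toLp T) (Lp.fourierTransformₗᵢ Position Spinor f), hT.coeFn_toLp] with p h1 h2
  rw [h1, h2]
  rfl

theorem fourier_ext {f g : OneParticle}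
    (h : Lp.fourierTransformₗᵢ Position Spinor f =ᵐ[volume]
      Lp.fourierTransformₗᵢ Position Spinor g) : f = g :=
  (Lp.fourierTransformₗᵢ Position Spinor).injective (Lp.ext h)

theorem fourierMultiplier_one (T : Position → Spinor →L[ℂ] Spinor) (hT : MemLp T ∞ volume)
    (h : ∀ᵐ p, T p = 1) : fourierMultiplier T hT = 1 := by
  ext1 f
  refine fourier_ext ?_
  filter_upwards [fourier_fourierMultiplier T hT f, h] with p h1 h2
  rw [h1, h2, one_apply_eq_self, one_apply_eq_self]

theorem fourierMultiplier_mul (T S R : Position → Spinor →L[ℂ] Spinor) (hT : MemLp T ∞ volume)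
    (hS : MemLp S ∞ volume) (hR : MemLp R ∞ volume) (h : ∀ᵐ p, T p * S p = R p) :
    fourierMultiplier T hT * fourierMultiplier S hS = fourierMultiplier R hR := by
  ext1 f
  refine fourier_ext ?_
  rw [mul_apply_eq_comp]
  filter_upwards [fourier_fourierMultiplier T hT (fourierMultiplier S hS f),
    fourier_fourierMultiplier S hS f, fourier_fourierMultiplier R hR f, h] with p h1 h2 h3 h4
  rw [h1, h2, h3, ← h4, mul_apply_eq_comp]

theorem fourierMultiplier_add (T S R : Position → Spinor →L[ℂ] Spinor) (hT : MemLp T ∞ volume)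
    (hS : MemLp S ∞ volume) (hR : MemLp R ∞ volume) (h : ∀ᵐ p, T p + S p = R p) :
    fourierMultiplier T hT + fourierMultiplier S hS = fourierMultiplier R hR := by
  ext1 f
  refine fourier_ext ?_
  rw [add_apply, map_add]
  filter_upwards [fourier_fourierMultiplier T hT f, fourier_fourierMultiplier S hS f,
    fourier_fourierMultiplier R hR f, h, Lp.coeFn_add (Lp.fourierTransformₗᵢ Position Spinor
      (fourierMultiplier T hT f)) (Lp.fourierTransformₗᵢ Position Spinor
      (fourierMultiplier S hS f))] with p h1 h2 h3 h4 h5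
  rw [h5, Pi.add_apply, h1, h2, h3, ← h4, add_apply]

theorem inner_fourierMultiplier (T : Position → Spinor →L[ℂ] Spinor) (hT : MemLp T ∞ volume)
    (h : ∀ᵐ p, IsSelfAdjoint (T p)) (f g : OneParticle) :
    inner ℂ (fourierMultiplier T hT f) g = inner ℂ f (fourierMultiplier T hT g) := by
  rw [← (Lp.fourierTransformₗᵢ Position Spinor).inner_map_map,
    ← (Lp.fourierTransformₗᵢ Position Spinor).inner_map_map f, L2.inner_def, L2.inner_def]
  refine integral_congr_ae ?_
  filter_upwards [fourier_fourierMultiplier T hT f, fourier_fourierMultiplier T hT g, h]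
    with p h1 h2 h3
  rw [h1, h2, ← ContinuousLinearMap.adjoint_inner_right, ← ContinuousLinearMap.star_eq_adjoint,
    h3.star_eq]

/-! ### The energy projections -/

section

variable (D : DiracMatrices) (m : ℝ)

/-- For `m = 0` the energy vanishes at `p = 0`, where the symbols of the projections are not
projections; this is a null set. -/
theorem ae_energy_ne_zero : ∀ᵐ p : Position, energy m p ≠ 0 := by
  have h : ∀ᵐ p : Position, p ≠ 0 := by
    rw [ae_iff]
    simp
  filter_upwards [h] with p hp
  have := norm_pos_iff.2 hp
  have := Real.pi_pos
  rw [energy]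
  positivity

theorem DiracMatrices.symbol_mul_symbol (p : Position) :
    D.symbol m p * D.symbol m p = ((energy m p : ℝ) : ℂ) ^ 2 • 1 := by
  rw [symbol, ← map_mul, symbolMatrix_sq, map_smul, map_one]
  push_cast
  rfl

theorem DiracMatrices.projSymbol_mul_self (σ : ℤˣ) {p : Position} (hp : energy m p ≠ 0) :
    D.projSymbol m σ p * D.projSymbol m σ p = D.projSymbol m σ p := by
  have hp' : ((energy m p : ℝ) : ℂ) ≠ 0 := by exact_mod_cast hp
  have hσ : ((σ : ℤ) : ℂ) ^ 2 = 1 := by rcases Int.units_eq_one_or σ with h | h <;> simp [h]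
  have h :
      (((σ : ℤ) : ℂ) * ((energy m p : ℝ) : ℂ)⁻¹ * (((σ : ℤ) : ℂ) * ((energy m p : ℝ) : ℂ)⁻¹)) *
      ((energy m p : ℝ) : ℂ) ^ 2 = 1 := by
    field_simp
    exact hσ
  simp only [projSymbol]
  generalize ((σ : ℤ) : ℂ) * ((energy m p : ℝ) : ℂ)⁻¹ = c at h
  rw [smul_mul_smul_comm, add_mul, mul_add, mul_add, smul_mul_smul_comm, symbol_mul_symbol,
    smul_smul, h]
  simp only [one_mul, mul_one]
  module

theorem DiracMatrices.projSymbol_add_neg (σ : ℤˣ) (p : Position) :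
    D.projSymbol m σ p + D.projSymbol m (-σ) p = 1 := by
  simp only [projSymbol]
  push_cast
  module

theorem DiracMatrices.isSelfAdjoint_projSymbol (σ : ℤˣ) (p : Position) :
    IsSelfAdjoint (D.projSymbol m σ p) := by
  have h1 : IsSelfAdjoint ((((σ : ℤ) : ℂ) * ((energy m p : ℝ) : ℂ)⁻¹) • D.symbol m p) :=
    IsSelfAdjoint.smul (by simp [IsSelfAdjoint]) (D.symbol_selfAdjoint m p)
  have h2 : IsSelfAdjoint (1 + (((σ : ℤ) : ℂ) * ((energy m p : ℝ) : ℂ)⁻¹) • D.symbol m p) := by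
    have h := ContinuousLinearMap.isSelfAdjoint_iff'.1 h1
    refine ContinuousLinearMap.isSelfAdjoint_iff'.2 ?_
    rw [map_add, h]
    congr 1
    exact ContinuousLinearMap.adjoint_id
  exact IsSelfAdjoint.smul (by simp [IsSelfAdjoint]) h2

theorem diracProj_mul_self (σ : ℤˣ) : diracProj D m σ * diracProj D m σ = diracProj D m σ :=
  fourierMultiplier_mul _ _ _ _ _ _ <| by
    filter_upwards [ae_energy_ne_zero m] with p hp using D.projSymbol_mul_self m σ hp

theorem diracProj_add_neg (σ : ℤˣ) : diracProj D m σ + diracProj D m (-σ) = 1 := by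
  have h : MemLp (fun _ : Position => (1 : Spinor →L[ℂ] Spinor)) ∞ volume :=
    memLp_top_const _
  rw [← fourierMultiplier_one _ h (Filter.Eventually.of_forall fun _ => rfl)]
  exact fourierMultiplier_add _ _ _ _ _ _ (Filter.Eventually.of_forall (D.projSymbol_add_neg m σ))

theorem inner_diracProj (σ : ℤˣ) (f g : OneParticle) :
    inner ℂ (diracProj D m σ f) g = inner ℂ f (diracProj D m σ g) :=
  inner_fourierMultiplier _ _ (Filter.Eventually.of_forall (D.isSelfAdjoint_projSymbol m σ)) f g

variable {D m}

theorem diracProj_of_mem {σ : ℤˣ} {f : OneParticle} (hf : f ∈ energySpace D m σ) :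
    diracProj D m σ f = f := by
  obtain ⟨g, rfl⟩ := hf
  exact DFunLike.congr_fun (diracProj_mul_self D m σ) g

theorem diracProj_neg_of_mem {σ : ℤˣ} {f : OneParticle} (hf : f ∈ energySpace D m σ) :
    diracProj D m (-σ) f = 0 := by
  have := DFunLike.congr_fun (diracProj_add_neg D m σ) f
  rw [add_apply, diracProj_of_mem hf, one_apply_eq_self] at this
  simpa using this

theorem inner_energySpace_neg {σ : ℤˣ} {f g : OneParticle} (hf : f ∈ energySpace D m σ)
    (hg : g ∈ energySpace D m (-σ)) : inner ℂ f g = 0 := by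
  rw [← diracProj_of_mem hf, inner_diracProj]
  have := diracProj_neg_of_mem hg
  rw [neg_neg] at this
  rw [this, inner_zero_right]

variable (D m)

theorem isClosed_energySpace (σ : ℤˣ) : IsClosed (energySpace D m σ : Set OneParticle) := by
  have : (energySpace D m σ : Set OneParticle) = {f | diracProj D m σ f = f} :=
    Set.ext fun f => ⟨diracProj_of_mem, fun h => ⟨f, h⟩⟩
  rw [this]
  exact isClosed_eq (by fun_prop) continuous_id

/-! ### Both energy spaces are infinite-dimensional -/

/-- The chirality matrix `α¹ α² α³ β`. -/
def DiracMatrices.chirality : Matrix (Fin 4) (Fin 4) ℂ := D.α 0 * D.α 1 * D.α 2 * D.β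

theorem DiracMatrices.α_mul_self (k : Fin 3) : D.α k * D.α k = 1 := by
  have h := D.α_anti k k
  rw [if_pos rfl, ← two_smul ℂ] at h
  refine smul_right_injective _ (two_ne_zero (α := ℂ)) ?_
  simp only [h, two_smul, one_add_one_eq_two]

theorem DiracMatrices.α_mul_comm {k l : Fin 3} (h : k ≠ l) : D.α k * D.α l = -(D.α l * D.α k) := by
  have := D.α_anti k l
  rw [if_neg h] at this
  exact eq_neg_of_add_eq_zero_left this

theorem DiracMatrices.β_mul_comm (k : Fin 3) : D.β * D.α k = -(D.α k * D.β) :=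
  eq_neg_of_add_eq_zero_right (D.αβ_anti k)

/-- A product of an even number of anticommuting matrices anticommutes with each factor. -/
theorem DiracMatrices.chirality_mul_symbolMatrix (p : Position) :
    D.chirality * D.symbolMatrix m p = -(D.symbolMatrix m p * D.chirality) := by
  have h00 := D.α_mul_self 0
  have h11 := D.α_mul_self 1
  have h22 := D.α_mul_self 2
  have h10 := D.α_mul_comm (show (1 : Fin 3) ≠ 0 by decide)
  have h20 := D.α_mul_comm (show (2 : Fin 3) ≠ 0 by decide)
  have h21 := D.α_mul_comm (show (2 : Fin 3) ≠ 1 by decide)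
  have b0 := D.β_mul_comm 0
  have b1 := D.β_mul_comm 1
  have b2 := D.β_mul_comm 2
  have bb := D.β_sq
  simp only [chirality, symbolMatrix, Fin.sum_univ_three]
  generalize D.α 0 = A at *
  generalize D.α 1 = B at *
  generalize D.α 2 = C at *
  generalize D.β = E at *
  -- rules that move the factors `A`, `B`, `C`, `E` into this order, also inside a longer product
  have assoc : ∀ {X Y : Matrix (Fin 4) (Fin 4) ℂ}, Y * X = -(X * Y) →
      ∀ Z, Y * (X * Z) = -(X * (Y * Z)) := fun h Z => by
    rw [← mul_assoc, h, neg_mul, mul_assoc]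
  have cancel : ∀ {X : Matrix (Fin 4) (Fin 4) ℂ}, X * X = 1 → ∀ Z, X * (X * Z) = Z :=
    fun h Z => by rw [← mul_assoc, h, one_mul]
  simp only [mul_add, add_mul, mul_smul_comm, smul_mul_assoc, mul_assoc, b0, b1, b2,
    assoc h10, assoc h20, assoc h21, assoc b0, assoc b1, assoc b2, bb, cancel h00,
    cancel h11, cancel h22, mul_neg, neg_neg, mul_one, smul_neg, neg_add]

theorem DiracMatrices.chirality_mul_reverse :
    D.chirality * (D.β * D.α 2 * D.α 1 * D.α 0) = 1 := by
  have cancel : ∀ {X : Matrix (Fin 4) (Fin 4) ℂ}, X * X = 1 → ∀ Z, X * (X * Z) = Z :=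
    fun h Z => by rw [← mul_assoc, h, one_mul]
  simp only [chirality, mul_assoc, cancel D.β_sq, cancel (D.α_mul_self _), D.α_mul_self]

/-- A constant matrix, acting on spinors pointwise in momentum space. -/
def constMultiplier (M : Matrix (Fin 4) (Fin 4) ℂ) : OneParticle →L[ℂ] OneParticle :=
  fourierMultiplier (fun _ => Matrix.toEuclideanCLM (𝕜 := ℂ) M) (memLp_top_const _)

theorem diracProj_neg_mul_chirality (σ : ℤˣ) :
    diracProj D m (-σ) * constMultiplier D.chirality =
      constMultiplier D.chirality * diracProj D m σ := by
  have hT : MemLp (fun p => Matrix.toEuclideanCLM (𝕜 := ℂ) D.chirality * D.projSymbol m σ p)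
      ∞ volume :=
    (D.memLp_projSymbol m σ).const_mul _
  refine (fourierMultiplier_mul _ _ _ _ _ hT (Filter.Eventually.of_forall fun p => ?_)).trans
    (fourierMultiplier_mul _ _ _ _ _ hT (Filter.Eventually.of_forall fun p => rfl)).symm
  have h : Matrix.toEuclideanCLM (𝕜 := ℂ) D.chirality * D.symbol m p =
      -(D.symbol m p * Matrix.toEuclideanCLM (𝕜 := ℂ) D.chirality) := by
    rw [DiracMatrices.symbol, ← map_mul, D.chirality_mul_symbolMatrix, map_neg, map_mul]
  simp only [DiracMatrices.projSymbol]
  rw [smul_mul_assoc, mul_smul_comm, add_mul, mul_add, smul_mul_assoc, mul_smul_comm, h]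
  push_cast
  simp only [one_mul, mul_one]
  module

theorem constMultiplier_chirality_mul :
    constMultiplier D.chirality * constMultiplier (D.β * D.α 2 * D.α 1 * D.α 0) = 1 := by
  have h : MemLp (fun _ : Position => (1 : Spinor →L[ℂ] Spinor)) ∞ volume :=
    memLp_top_const _
  rw [← fourierMultiplier_one _ h (Filter.Eventually.of_forall fun _ => rfl)]
  refine fourierMultiplier_mul _ _ _ _ _ _ (Filter.Eventually.of_forall fun p => ?_)
  rw [← map_mul, D.chirality_mul_reverse, map_one]

/-- The indicator functions of disjoint balls are linearly independent. -/
theorem oneParticle_infinite : ¬ FiniteDimensional ℂ OneParticle := by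
  intro hfin
  let c : ℕ → Position := fun n => EuclideanSpace.single 0 (n : ℝ)
  have hc : ∀ i j, i ≠ j → 1 ≤ dist (c i) (c j) := by
    intro i j hij
    rw [PiLp.dist_single_same, Real.dist_eq]
    have : (1 : ℤ) ≤ |(i : ℤ) - j| := Int.one_le_abs (by omega)
    exact_mod_cast this
  let v : ℕ → OneParticle := fun n => indicatorConstLp 2
    (measurableSet_ball (x := c n) (ε := 1 / 2)) measure_ball_lt_top.ne
    (EuclideanSpace.single 0 1 : Spinor)
  have hv : ∀ i j, inner ℂ (v i) (v j) =
      (volume.real (Metric.ball (c i) (1 / 2) ∩ Metric.ball (c j) (1 / 2)) : ℂ) := by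
    intro i j
    rw [L2.inner_indicatorConstLp_indicatorConstLp]
    simp
  have hli : LinearIndependent ℂ v := by
    refine linearIndependent_of_ne_zero_of_inner_eq_zero (fun i hi => ?_) fun i j hij => ?_
    · have h := hv i i
      rw [hi, inner_zero_left, Set.inter_self] at h
      have h1 : 0 < volume.real (Metric.ball (c i) (1 / 2)) :=
        ENNReal.toReal_pos (Metric.measure_ball_pos _ _ (by norm_num)).ne' measure_ball_lt_top.ne
      have : (volume.real (Metric.ball (c i) (1 / 2))) = 0 := by exact_mod_cast h.symm
      exact h1.ne' this
    · have hd : Disjoint (Metric.ball (c i) (1 / 2)) (Metric.ball (c j) (1 / 2)) :=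
        Metric.ball_disjoint_ball (by have := hc i j hij; linarith)
      show inner ℂ (v i) (v j) = 0
      rw [hv, hd.inter_eq]
      simp
  have : Finite ℕ := hli.finite
  exact not_finite ℕ

/-- The chirality matrix maps one energy space onto the other, and their sum is everything. -/
theorem energySpace_infinite (σ : ℤˣ) : ¬ FiniteDimensional ℂ (energySpace D m σ) := by
  intro h
  have h1 : energySpace D m (-σ) ≤
      (energySpace D m σ).map (constMultiplier D.chirality).toLinearMap := by
    rintro _ ⟨f, rfl⟩
    refine ⟨_, diracProj_mem D m σ (constMultiplier (D.β * D.α 2 * D.α 1 * D.α 0) f), ?_⟩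
    have e1 := DFunLike.congr_fun (diracProj_neg_mul_chirality D m σ)
      (constMultiplier (D.β * D.α 2 * D.α 1 * D.α 0) f)
    have e2 := DFunLike.congr_fun (constMultiplier_chirality_mul D) f
    rw [mul_apply_eq_comp, mul_apply_eq_comp] at e1
    rw [mul_apply_eq_comp, one_apply_eq_self] at e2
    rw [e2] at e1
    exact e1.symm
  have h2 : FiniteDimensional ℂ (energySpace D m (-σ)) :=
    Submodule.finiteDimensional_of_le h1
  have h3 : energySpace D m σ ⊔ energySpace D m (-σ) = ⊤ := by
    refine (Submodule.eq_top_iff').2 fun f => ?_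
    have := DFunLike.congr_fun (diracProj_add_neg D m σ) f
    rw [add_apply, one_apply_eq_self] at this
    rw [← this]
    exact Submodule.add_mem_sup (diracProj_mem D m σ f) (diracProj_mem D m (-σ) f)
  have h4 : FiniteDimensional ℂ (⊤ : Submodule ℂ OneParticle) := h3 ▸ inferInstance
  exact oneParticle_infinite (Module.finite_def.2 (Module.Finite.iff_fg.1 h4))

/-- A separable Hilbert space of infinite dimension has an orthonormal basis indexed by `ℕ`. -/
theorem exists_hilbertBasis_nat (E : Type*) [NormedAddCommGroup E] [InnerProductSpace ℂ E]
    [CompleteSpace E] [TopologicalSpace.SeparableSpace E] (h : ¬ FiniteDimensional ℂ E) :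
    Nonempty (HilbertBasis ℕ ℂ E) := by
  obtain ⟨w, b, hb⟩ := exists_hilbertBasis ℂ E
  have hc : Countable w := by
    refine Pairwise.countable_of_isOpen_disjoint (s := fun i => Metric.ball (b i) (1 / 2))
      (fun i j hij => Metric.ball_disjoint_ball ?_) (fun _ => Metric.isOpen_ball)
      fun i => ⟨b i, Metric.mem_ball_self (by norm_num)⟩
    have h2 : ‖b i - b j‖ ^ 2 = 2 := by
      rw [@norm_sub_sq ℂ, b.orthonormal.inner_eq_zero hij, b.orthonormal.norm_eq_one,
        b.orthonormal.norm_eq_one]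
      norm_num
    rw [dist_eq_norm]
    nlinarith [norm_nonneg (b i - b j)]
  have hi : Infinite w := by
    by_contra hfin
    rw [not_infinite_iff_finite] at hfin
    have := Fintype.ofFinite w
    exact h b.toOrthonormalBasis.toBasis.finiteDimensional_of_finite
  obtain ⟨φ⟩ : Nonempty (ℕ ≃ w) := nonempty_equiv_of_countable
  refine ⟨HilbertBasis.mk (v := b ∘ φ) (b.orthonormal.comp φ φ.injective) ?_⟩
  rw [φ.surjective.range_comp, b.dense_span]

end

/-! ### Existence of compatible bases and of charge conjugations -/

section

variable (D : DiracMatrices) (m : ℝ)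

theorem exists_energySpace_basis (σ : ℤˣ) : ∃ v : ℕ → OneParticle, Orthonormal ℂ v ∧
    (∀ n, v n ∈ energySpace D m σ) ∧
    ∀ f ∈ energySpace D m σ, (∀ n, inner ℂ (v n) f = 0) → f = 0 := by
  have : CompleteSpace (energySpace D m σ) := (isClosed_energySpace D m σ).completeSpace_coe
  have : Fact ((2 : ℝ≥0∞) ≠ ∞) := ⟨by norm_num⟩
  have : SecondCountableTopology OneParticle := inferInstance
  obtain ⟨b⟩ := exists_hilbertBasis_nat (energySpace D m σ) (energySpace_infinite D m σ)
  refine ⟨fun n => b n, b.orthonormal.comp_linearIsometry (energySpace D m σ).subtypeₗᵢ,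
    fun n => (b n).2, fun f hf h => ?_⟩
  have : b.repr ⟨f, hf⟩ = 0 := by
    ext n
    rw [b.repr_apply_apply]
    exact h n
  have := b.repr.map_eq_zero_iff.1 this
  exact congrArg Subtype.val this

theorem exists_compatibleBasis :
    ∃ e : HilbertBasis NZ ℂ OneParticle, IsCompatibleBasis D m e := by
  obtain ⟨v, hv, hvm, hv0⟩ := exists_energySpace_basis D m 1
  obtain ⟨w, hw, hwm, hw0⟩ := exists_energySpace_basis D m (-1)
  let u : NZ → OneParticle := fun i =>
    if 0 < i.1 then v (i.1 - 1).toNat else w (-i.1 - 1).toNat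
  have hpos : ∀ i : NZ, 0 < i.1 → u i = v (i.1 - 1).toNat := fun i hi => if_pos hi
  have hneg : ∀ i : NZ, i.1 < 0 → u i = w (-i.1 - 1).toNat := fun i hi => if_neg (by omega)
  have hcases : ∀ i : NZ, 0 < i.1 ∨ i.1 < 0 := fun i => by have := i.2; omega
  have hu : Orthonormal ℂ u := by
    refine ⟨fun i => ?_, fun i j hij => ?_⟩
    · rcases hcases i with h | h
      · rw [hpos i h, hv.norm_eq_one]
      · rw [hneg i h, hw.norm_eq_one]
    · have hij : i.1 ≠ j.1 := fun h => hij (Subtype.ext h)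
      show inner ℂ (u i) (u j) = 0
      rcases hcases i with h | h <;> rcases hcases j with h' | h'
      · rw [hpos i h, hpos j h', hv.inner_eq_zero (by omega)]
      · rw [hpos i h, hneg j h', inner_energySpace_neg (hvm _) (hwm _)]
      · rw [hneg i h, hpos j h', ← inner_conj_symm, inner_energySpace_neg (hvm _) (hwm _), map_zero]
      · rw [hneg i h, hneg j h', hw.inner_eq_zero (by omega)]
  refine ⟨HilbertBasis.mkOfOrthogonalEqBot hu ?_, fun i => ⟨fun h => ?_, fun h => ?_⟩⟩
  · rw [Submodule.eq_bot_iff]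
    intro f hf
    have hf' : ∀ i, inner ℂ (u i) f = 0 := fun i =>
      (Submodule.mem_orthogonal _ _).1 hf _ (Submodule.subset_span ⟨i, rfl⟩)
    have h1 : diracProj D m 1 f = 0 := by
      refine hv0 _ (diracProj_mem D m 1 f) fun n => ?_
      have := hf' ⟨n + 1, by omega⟩
      rw [hpos _ (by show (0 : ℤ) < n + 1; omega)] at this
      rw [← inner_diracProj, diracProj_of_mem (hvm n)]
      simpa using this
    have h2 : diracProj D m (-1) f = 0 := by
      refine hw0 _ (diracProj_mem D m (-1) f) fun n => ?_
      have := hf' ⟨-(n + 1), by omega⟩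
      rw [hneg _ (by show -((n : ℤ) + 1) < 0; omega)] at this
      rw [← inner_diracProj, diracProj_of_mem (hwm n)]
      simpa using this
    have := DFunLike.congr_fun (diracProj_add_neg D m 1) f
    rw [add_apply, h1, h2, add_zero, one_apply_eq_self] at this
    exact this.symm
  · rw [HilbertBasis.coe_mkOfOrthogonalEqBot, hpos i h]
    exact hvm _
  · rw [HilbertBasis.coe_mkOfOrthogonalEqBot, hneg i h]
    exact hwm _

variable {D m}

/-- The antilinear extension of `eᵢ ↦ e₋ᵢ` is a charge conjugation. -/
theorem IsCompatibleBasis.exists_chargeConjugation {e : HilbertBasis NZ ℂ OneParticle}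
    (he : IsCompatibleBasis D m e) :
    ∃ C : OneParticle →ₛₗ[starRingEnd ℂ] OneParticle, IsChargeConjugation D m C := by
  let ν : NZ ≃ NZ :=
    ⟨fun i => ⟨-i.1, neg_ne_zero.2 i.2⟩, fun i => ⟨-i.1, neg_ne_zero.2 i.2⟩,
      fun i => Subtype.ext (neg_neg _), fun i => Subtype.ext (neg_neg _)⟩
  have hνν : ∀ i, ν (ν i) = i := fun i => Subtype.ext (neg_neg _)
  let e' : HilbertBasis NZ ℂ OneParticle :=
    HilbertBasis.mk (v := e ∘ ν) (e.orthonormal.comp ν ν.injective) (by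
      rw [ν.surjective.range_comp, e.dense_span])
  have he' : ∀ i, e' i = e (ν i) := fun i => by
    rw [HilbertBasis.coe_mk, Function.comp_apply]
  -- take coordinates with respect to `e₋ᵢ`, conjugate them, and use them as coordinates for `eᵢ`
  let C : OneParticle →ₛₗ[starRingEnd ℂ] OneParticle :=
    { toFun := fun f => e.repr.symm (star (e'.repr f))
      map_add' := fun f g => by rw [map_add, star_add, map_add]
      map_smul' := fun c f => by rw [map_smul, star_smul, map_smul]; rfl }
  have hC : ∀ i f, inner ℂ (e i) (C f) = inner ℂ f (e (ν i)) := by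
    intro i f
    have : e.repr (C f) = star (e'.repr f) := e.repr.apply_symm_apply _
    rw [← e.repr_apply_apply, this, lp.star_apply, e'.repr_apply_apply, he']
    exact inner_conj_symm _ _
  have ext : ∀ f g : OneParticle, (∀ i, inner ℂ (e i) f = inner ℂ (e i) g) → f = g := by
    intro f g h
    refine e.repr.injective (lp.ext (funext fun i => ?_))
    rw [e.repr_apply_apply, e.repr_apply_apply, h]
  have hproj : ∀ i, (diracProj D m 1 (e i) = e i ∧ diracProj D m (-1) (e i) = 0 ∧
      diracProj D m 1 (e (ν i)) = 0 ∧ diracProj D m (-1) (e (ν i)) = e (ν i)) ∨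
      (diracProj D m 1 (e i) = 0 ∧ diracProj D m (-1) (e i) = e i ∧
      diracProj D m 1 (e (ν i)) = e (ν i) ∧ diracProj D m (-1) (e (ν i)) = 0) := by
    intro i
    have hν : (ν i).1 = -i.1 := rfl
    have h1 : ∀ f ∈ energySpace D m (-1), diracProj D m 1 f = 0 := fun f hf => by
      have := diracProj_neg_of_mem hf
      rwa [neg_neg] at this
    rcases lt_or_gt_of_ne i.2 with h | h
    · have a := (he i).2 h
      have b := (he (ν i)).1 (by omega)
      exact Or.inr ⟨h1 _ a, diracProj_of_mem a, diracProj_of_mem b, diracProj_neg_of_mem b⟩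
    · have a := (he i).1 h
      have b := (he (ν i)).2 (by omega)
      exact Or.inl ⟨diracProj_of_mem a, diracProj_neg_of_mem a, h1 _ b, diracProj_of_mem b⟩
  refine ⟨C, fun f => ext _ _ fun i => ?_, fun f g => ?_, fun σ f => ext _ _ fun i => ?_⟩
  · rw [hC, ← inner_conj_symm, hC, inner_conj_symm, hνν]
  · rw [← e.tsum_inner_mul_inner, ← e'.tsum_inner_mul_inner]
    refine tsum_congr fun i => ?_
    rw [hC, ← inner_conj_symm, hC, inner_conj_symm, he', mul_comm]
  · rw [hC, inner_diracProj D m σ f, ← inner_diracProj D m (-σ) (e i)]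
    rcases Int.units_eq_one_or σ with rfl | rfl <;>
      rcases hproj i with ⟨h1, h2, h3, h4⟩ | ⟨h1, h2, h3, h4⟩ <;>
      simp only [neg_neg, h1, h2, h3, h4, inner_zero_left, inner_zero_right, hC]

variable (D m) in
theorem exists_chargeConjugation :
    ∃ C : OneParticle →ₛₗ[starRingEnd ℂ] OneParticle, IsChargeConjugation D m C :=
  (exists_compatibleBasis D m).elim fun _ he => he.exists_chargeConjugation

/-! ### The representation on the Dirac sea -/

theorem IsChargeConjugation.map_mem_neg {C : OneParticle →ₛₗ[starRingEnd ℂ] OneParticle}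
    (hC : IsChargeConjugation D m C) {σ : ℤˣ} {f : OneParticle} (hf : f ∈ energySpace D m σ) :
    C f ∈ energySpace D m (-σ) := by
  rw [← diracProj_of_mem hf, hC.map_proj]
  exact diracProj_mem D m (-σ) _

variable {e : HilbertBasis NZ ℂ OneParticle} {C : OneParticle →ₛₗ[starRingEnd ℂ] OneParticle}

theorem IsCompatibleBasis.psi_seaVacuum (he : IsCompatibleBasis D m e) {f : OneParticle}
    (hf : f ∈ energySpace D m 1) : psi e f seaVacuum = 0 := by
  refine ((hasSum_psi e f).mapL (ContinuousLinearMap.apply ℂ SeaSpace seaVacuum)).unique ?_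
  convert hasSum_zero with i
  simp only [ContinuousLinearMap.apply_apply, smul_apply]
  rcases lt_or_gt_of_ne i.2 with h | h
  · rw [inner_energySpace_neg hf ((he i).2 h), zero_smul]
  · rw [seaVacuum, psiBasis_of_not_has, smul_zero]
    rw [SeaSeq.has_sea]
    omega

theorem IsCompatibleBasis.psiStar_seaVacuum (he : IsCompatibleBasis D m e) {f : OneParticle}
    (hf : f ∈ energySpace D m (-1)) : psiStar e f seaVacuum = 0 := by
  refine ((hasSum_psiStar e f).mapL (ContinuousLinearMap.apply ℂ SeaSpace seaVacuum)).unique ?_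
  convert hasSum_zero with i
  simp only [ContinuousLinearMap.apply_apply, smul_apply]
  rcases lt_or_gt_of_ne i.2 with h | h
  · rw [seaVacuum, psiStarBasis_of_has, smul_zero]
    rw [SeaSeq.has_sea]
    exact h
  · rw [inner_energySpace_neg ((he i).1 h) hf, zero_smul]

theorem norm_seaVacuum : ‖seaVacuum‖ = 1 := by
  classical
  rw [seaVacuum, seaVec, lp.norm_single (by norm_num), norm_one]

/-- The representation on the Dirac sea: a particle is created by `ψ*(h)`, an antiparticle by
`ψ(C h)`. -/
def FockRep.sea (he : IsCompatibleBasis D m e) (hC : IsChargeConjugation D m C) :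
    FockRep (WithLp 2 (energySpace D m 1 × energySpace D m 1)) SeaSpace :=
  ofPair
    { toFun := fun h => psiStar e h
      map_add' := fun f g => psiStar_add e f g
      map_smul' := fun c f => psiStar_smul e c f }
    { toFun := fun h => psi e (C h)
      map_add' := fun f g => by rw [Submodule.coe_add, map_add, psi_add]
      map_smul' := fun c f => by
        rw [Submodule.coe_smul, map_smulₛₗ, psi_smul, starRingEnd_self_apply, RingHom.id_apply] }
    seaVacuum
    (fun f => psiStar_mul_self e f)
    (fun f => psi_mul_self e (C f))
    (fun f g => by
      have h : inner ℂ (C (g : OneParticle)) (f : OneParticle) = 0 := by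
        rw [← inner_conj_symm, inner_energySpace_neg f.2 (hC.map_mem_neg g.2), map_zero]
      have := psi_psiStar e (C g) f
      rw [h, zero_smul, add_comm] at this
      exact this)
    (fun f g => by
      simp only [LinearMap.coe_mk, AddHom.coe_mk, adjoint_psiStar]
      exact psi_psiStar e f g)
    (fun f g => by
      simp only [LinearMap.coe_mk, AddHom.coe_mk, adjoint_psi]
      rw [add_comm, psi_psiStar, hC.inner_map]
      rfl)
    (fun f g => by
      simp only [LinearMap.coe_mk, AddHom.coe_mk, adjoint_psiStar]
      exact psi_psi e f (C g))
    (fun f => by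
      simp only [LinearMap.coe_mk, AddHom.coe_mk, adjoint_psiStar]
      exact he.psi_seaVacuum f.2)
    (fun f => by
      simp only [LinearMap.coe_mk, AddHom.coe_mk, adjoint_psi]
      exact he.psiStar_seaVacuum (hC.map_mem_neg f.2))
    norm_seaVacuum
    (fun S hS h0 hA hB => by
      refine sea_cyclic S hS h0 (fun j hj Φ hΦ => ?_) fun j hj Φ hΦ => ?_
      · have : psiStar e (e j) Φ ∈ S := hA ⟨e j, (he j).1 hj⟩ Φ hΦ
        rwa [psiStar_basis] at this
      · have hj' : C (e j) ∈ energySpace D m 1 := by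
          have := hC.map_mem_neg ((he j).2 hj)
          rwa [neg_neg] at this
        have : psi e (C (C (e j))) Φ ∈ S := hB ⟨_, hj'⟩ Φ hΦ
        rwa [hC.involutive, psi_basis] at this)

namespace FockRep

theorem sea_vac (he : IsCompatibleBasis D m e) (hC : IsChargeConjugation D m C) :
    (sea he hC).vac = seaVacuum := by
  rw [sea, ofPair_vac]

theorem adjoint_sea_cre_left (he : IsCompatibleBasis D m e) (hC : IsChargeConjugation D m C)
    (h : energySpace D m 1) :
    ((sea he hC).cre (WithLp.toLp 2 (h, 0))).adjoint = psi e h := by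
  rw [sea, ofPair_cre_left, LinearMap.coe_mk, AddHom.coe_mk, adjoint_psiStar]

theorem sea_cre_right (he : IsCompatibleBasis D m e) (hC : IsChargeConjugation D m C)
    (h : energySpace D m 1) :
    (sea he hC).cre (WithLp.toLp 2 (0, h)) = psi e (C h) := by
  rw [sea, ofPair_cre_right, LinearMap.coe_mk, AddHom.coe_mk]

end FockRep

/-- The unitary equivalence in terms of the operators of the Dirac sea. The last clause combines an
annihilation with a creation operator, as in the field. -/
theorem exists_sea_unitary (he : IsCompatibleBasis D m e) (hC : IsChargeConjugation D m C) :
    ∃ U : SeaSpace ≃ₗᵢ[ℂ] FockPair (energySpace D m 1),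
      U seaVacuum = fockPairVacuum (energySpace D m 1) ∧
      (∀ (h : energySpace D m 1) (Φ : FockPair (energySpace D m 1)),
        U (seaA e h (U.symm Φ)) = fockA h Φ) ∧
      (∀ (h : energySpace D m 1) (Φ : FockPair (energySpace D m 1)),
        U (seaB e C h (U.symm Φ)) = fockB h Φ) ∧
      ∀ (h k : energySpace D m 1) (Φ : FockPair (energySpace D m 1)),
        U ((seaA e h + (seaB e C k).adjoint) (U.symm Φ)) = (fockA h + (fockB k).adjoint) Φ := by
  have h := (FockRep.sea he hC).exists_unitary_fockPair
  simpa only [FockRep.sea_vac, FockRep.adjoint_sea_cre_left, FockRep.sea_cre_right, adjoint_psi,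
    seaA, seaB, adjoint_psiStar] using h

/-- The field of the Dirac sea annihilates particles and creates antiparticles. -/
theorem psi_eq_seaA_add (hC : IsChargeConjugation D m C) (f : OneParticle) :
    psi e f = seaA e ⟨diracProj D m 1 f, diracProj_mem D m 1 f⟩ +
      (seaB e C ⟨C (diracProj D m (-1) f), hC.map_neg_mem f⟩).adjoint := by
  have h := DFunLike.congr_fun (diracProj_add_neg D m 1) f
  rw [add_apply, one_apply_eq_self] at h
  rw [seaA, seaB, adjoint_psiStar, hC.involutive, ← psi_add, h]

end

end DiracSea

end

open DiracSea
theorem theorem4 (D : DiracMatrices) (m : ℝ) :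
    (∃ e : HilbertBasis NZ ℂ OneParticle, IsCompatibleBasis D m e) ∧
    (∃ C : OneParticle →ₛₗ[starRingEnd ℂ] OneParticle, IsChargeConjugation D m C) ∧
    ∀ (e : HilbertBasis NZ ℂ OneParticle), IsCompatibleBasis D m e →
      (∀ f, Summable fun i : NZ => inner ℂ f (e i) • psiBasis i) ∧
      (∀ f, Summable fun i : NZ => inner ℂ (e i) f • psiStarBasis i) ∧
      ∀ (C : OneParticle →ₛₗ[starRingEnd ℂ] OneParticle) (hC : IsChargeConjugation D m C),
        ∃ U : SeaSpace ≃ₗᵢ[ℂ] FockPair (energySpace D m 1),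
          U seaVacuum = fockPairVacuum (energySpace D m 1) ∧
          (∀ (h : energySpace D m 1) (Φ : FockPair (energySpace D m 1)),
            U (seaA e h (U.symm Φ)) = fockA h Φ) ∧
          (∀ (h : energySpace D m 1) (Φ : FockPair (energySpace D m 1)),
            U (seaB e C h (U.symm Φ)) = fockB h Φ) ∧
          (∀ (t : ℝ) (f : OneParticle) (Φ : FockPair (energySpace D m 1)),
            U (seaField D m e t f (U.symm Φ)) = fockField hC t f Φ) := by
  refine ⟨exists_compatibleBasis D m, exists_chargeConjugation D m, fun e he => ?_⟩
  refine ⟨summable_psi e, summable_psiStar e, fun C hC => ?_⟩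
  refine (exists_sea_unitary he hC).imp fun U h => ⟨h.1, h.2.1, h.2.2.1, fun t f Φ => ?_⟩
  exact (congrArg (fun T : SeaSpace →L[ℂ] SeaSpace => U (T (U.symm Φ)))
    (psi_eq_seaA_add hC (diracEvol D m t f))).trans (h.2.2.2 _ _ Φ)
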